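/- **Setting.** Let $H$ be a separable real Hilbert space, let $\mathcal H$ be the real Hilbert space of self-adjoint Hilbert–Schmidt operators on $H$ with the Hilbert–Schmidt inner product $\langle\cdot,\cdot\rangle$ and norm $\|\cdot\|$, let $\mathcal H^+\subset\mathcal H$ be the cone of positive operators, and let $\chi(\xi)=\xi 1_{\{\|\xi\|\le 1\}}$ for $\xi\in\mathcal H$. Write $H+iH$ for the complexification of $H$, and $(a\otimes a)h=\langle a,h\rangle_H\,a$, extended complex-bilinearly (so $(ia)\otimes(ia)=-a\otimes a$). Let $(b,B,m,\mu)$ be an admissible parameter set, that is: 1. $b\in\mathcal H^+$; 2. $m$ is a $[0,\infty]$-valued Borel measure on $\mathcal H^+\setminus\{0\}$ with $\int\|\xi\|^2\,m(d\xi)<\infty$ and $\int|\langle\chi(\xi),h\rangle|\,m(d\xi)<\infty$ for all $h\in\mathcal H$; there is $I_m\in\mathcal H$ with $\langle I_m,h\rangle=\int\langle\chi(\xi),h\rangle\,m(d\xi)$ for all $h\in\mathcal H$; and $\langle b,v\rangle-\int\langle\chi(\xi),v\rangle\,m(d\xi)\ge0$ for all $v\in\mathcal H^+$; 3. $\mu$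 is an $\mathcal H^+$-valued (countably additive) Borel measure on $\mathcal H^+\setminus\{0\}$ with $\int\langle\chi(\xi),u\rangle\frac{\langle\mu(d\xi),x\rangle}{\|\xi\|^2}<\infty$ for all $u,x\in\mathcal H^+$ with $\langle u,x\rangle=0$; 4. $B\in\mathcal L(\mathcal H)$ and $\langle B^*(u),x\rangle-\int\langle\chi(\xi),u\rangle\frac{\langle\mu(d\xi),x\rangle}{\|\xi\|^2}\ge0$ for all $u,x\in\mathcal H^+$ with $\langle u,x\rangle=0$. Let $D\in\mathcal L(H)$ be positive and self-adjoint. For $u\in\mathcal H^+$ and $h\in iH$ put $$F(u)=\langle b,u\rangle-\int\big(e^{-\langle\xi,u\rangle}-1+\langle\chi(\xi),u\rangle\big)\,m(d\xi),$$ $$R(h,u)=B^*(u)-\tfrac12\,D^{1/2}h\otimes D^{1/2}h-\int\big(e^{-\langle\xi,u\rangle}-1+\langle\chi(\xi),u\rangle\big)\frac{\mu(d\xi)}{\|\xi\|^2},$$ where the last integral is the element of $\mathcal H$ defined weakly, by pairing with the elements of $\mathcal H$. Let $T\ge0$, $u_1\in iH$, $u_2\in\mathcal H^+$. For a densely defined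 operator $\mathcal A$ on $H$, a mild solution on $[0,T]$ of the generalised Riccati equations for $\mathcal A$ is a triple $(\Phi,\psi_1,\psi_2)$ with $\Phi\in C^1([0,T];[0,\infty))$, $\psi_1\in C([0,T];iH)$, $\psi_2\in C^1([0,T];\mathcal H^+)$, with $\Phi(0)=0$, $\psi_1(0)=u_1$, $\psi_2(0)=u_2$, and, for $0<t\le T$, $$\Phi'(t)=F(\psi_2(t)),\qquad \psi_1(t)=u_1-i\mathcal A^*\Big(i\int_0^t\psi_1(s)\,ds\Big),\qquad \psi_2'(t)=R(\psi_1(t),\psi_2(t)),$$ where it is required that $i\int_0^t\psi_1(s)\,ds\in\operatorname{dom}(\mathcal A^*)$. **Proposition.** Let $(\mathcal A,\operatorname{dom}(\mathcal A))$ be the generator of a strongly continuous semigroup on $H$, and let $\mathcal A^{(n)}=n\mathcal A(nI-\mathcal A)^{-1}$ be its Yosida approximations, which are defined for all large $n\in\mathbb N$. Let $(\Phi,\psi_1,\psi_2)$ be a mild solution on $[0,T]$ of the generalised Riccati equations for $\mathcal A$ and, for all large $n$, let $(\Phi^{(n)},\psi_1^{(n)},\psi_2^{(n)})$ be a mild solution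 on $[0,T]$ for $\mathcal A^{(n)}$, all with the same initial data $(0,u_1,u_2)$. Then $$\lim_{n\to\infty}\ \sup_{t\in[0,T]}\big|\Phi^{(n)}(t)-\Phi(t)\big|=0$$ and $$\lim_{n\to\infty}\Big(\sup_{t\in[0,T]}\big\|\psi_1^{(n)}(t)-\psi_1(t)\big\|_{H+iH}+\sup_{t\in[0,T]}\big\|\psi_2^{(n)}(t)-\psi_2(t)\big\|\Big)=0 .$$ -/

import Mathlib

open Filter Topology MeasureTheory Set
open scoped RealInnerProductSpace

noncomputable section

namespace YosidaRiccati

universe u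

section HilbertSchmidt

lemma summable_sq_add {E : Type*} [NormedAddCommGroup E] {ι : Type*} {f g : ι → E} (hf : Summable fun i => ‖f i‖ ^ 2)
    (hg : Summable fun i => ‖g i‖ ^ 2) : Summable fun i => ‖f i + g i‖ ^ 2 := by
  refine Summable.of_nonneg_of_le (fun i => by positivity) (fun i => ?_)
    ((hf.mul_left 2).add (hg.mul_left 2))
  have h1 := norm_add_le (f i) (g i)
  have h2 := norm_nonneg (f i + g i)
  nlinarith [sq_nonneg (‖f i‖ - ‖g i‖)]

/-- Parseval: `∑ᵢ ⟨bᵢ, x⟩² = ‖x‖²`. -/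
lemma hasSum_sq_inner {E : Type*} [NormedAddCommGroup E] [InnerProductSpace ℝ E]
    {ι : Type*} (b : HilbertBasis ι ℝ E) (x : E) :
    HasSum (fun i => ⟪b i, x⟫ ^ 2) (‖x‖ ^ 2) := by
  have := b.hasSum_inner_mul_inner x x
  rw [real_inner_self_eq_norm_sq] at this
  simpa only [real_inner_comm (b _) x, ← sq] using this

variable (H : Type u) [NormedAddCommGroup H] [InnerProductSpace ℝ H] [CompleteSpace H]

/-- Index set of a fixed orthonormal basis of `H`. -/
def OnbIndex : Set H := (exists_hilbertBasis ℝ H).choose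

/-- A fixed orthonormal (Hilbert) basis of `H`. The Hilbert-Schmidt inner product defined with it
does not depend on it, see `hasSum_inner_of_basis`. -/
def onb : HilbertBasis (OnbIndex H) ℝ H := (exists_hilbertBasis ℝ H).choose_spec.choose

/-- The bounded self-adjoint operators `A` on `H` that are Hilbert-Schmidt,
`∑ ‖A eᵢ‖² < ∞`, as a linear subspace of the bounded operators. -/
def selfAdjHSSubmodule : Submodule ℝ (H →L[ℝ] H) where
  carrier := {A | IsSelfAdjoint A ∧ Summable fun i => ‖A (onb H i)‖ ^ 2}
  zero_mem' := ⟨IsSelfAdjoint.zero _, by simp⟩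
  add_mem' := fun {A C} hA hC => ⟨hA.1.add hC.1, summable_sq_add hA.2 hC.2⟩
  smul_mem' := fun c A hA => ⟨(IsSelfAdjoint.all c).smul hA.1, by
    simpa [norm_smul, mul_pow] using hA.2.mul_left (c ^ 2)⟩

/-- The space `𝓗` of self-adjoint Hilbert-Schmidt operators on `H`. It is a type of its own since
it carries the Hilbert-Schmidt norm and not the operator norm. -/
def SelfAdjHS : Type u := selfAdjHSSubmodule H

instance : AddCommGroup (SelfAdjHS H) := inferInstanceAs (AddCommGroup (selfAdjHSSubmodule H))
instance : Module ℝ (SelfAdjHS H) := inferInstanceAs (Module ℝ (selfAdjHSSubmodule H))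

variable {H}

/-- The operator on `H` underlying an element of `𝓗`. -/
def SelfAdjHS.op : SelfAdjHS H →ₗ[ℝ] (H →L[ℝ] H) := (selfAdjHSSubmodule H).subtype

lemma SelfAdjHS.op_injective : Function.Injective (SelfAdjHS.op (H := H)) := Subtype.val_injective

lemma SelfAdjHS.isSelfAdjoint_op (A : SelfAdjHS H) : IsSelfAdjoint A.op := A.2.1

lemma SelfAdjHS.summable_op (A : SelfAdjHS H) : Summable fun i => ‖A.op (onb H i)‖ ^ 2 := A.2.2

lemma SelfAdjHS.inner_op (A : SelfAdjHS H) (x y : H) : ⟪A.op x, y⟫ = ⟪x, A.op y⟫ :=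
  A.isSelfAdjoint_op.isSymmetric x y

/-- The sequence `(A eᵢ)ᵢ` in `ℓ²(H)`. -/
def SelfAdjHS.coeffs : SelfAdjHS H →ₗ[ℝ] lp (fun _ : OnbIndex H => H) 2 where
  toFun A := ⟨fun i => A.op (onb H i), (memℓp_gen_iff (by simp)).2 (by simpa using A.summable_op)⟩
  map_add' A C := by ext i; simp; rfl
  map_smul' c A := by ext i; simp

lemma SelfAdjHS.coeffs_apply (A : SelfAdjHS H) (i : OnbIndex H) :
    A.coeffs i = A.op (onb H i) := rfl

lemma SelfAdjHS.coeffs_injective : Function.Injective (SelfAdjHS.coeffs (H := H)) := by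
  rw [injective_iff_map_eq_zero]
  intro A hA
  apply SelfAdjHS.op_injective
  rw [map_zero]
  refine ContinuousLinearMap.ext_on (s := Set.range (onb H))
    (Submodule.dense_iff_topologicalClosure_eq_top.2 (onb H).dense_span) ?_
  rintro _ ⟨i, rfl⟩
  rw [← A.coeffs_apply i, hA]
  rfl

/-- The Hilbert-Schmidt norm; see `SelfAdjHS.norm_sq_eq`. -/
instance : NormedAddCommGroup (SelfAdjHS H) :=
  NormedAddCommGroup.induced (SelfAdjHS H) (lp (fun _ : OnbIndex H => H) 2) SelfAdjHS.coeffs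
    SelfAdjHS.coeffs_injective

lemma SelfAdjHS.norm_coeffs (A : SelfAdjHS H) : ‖A.coeffs‖ = ‖A‖ := rfl

/-- The Hilbert-Schmidt inner product `⟨A, C⟩ = ∑ᵢ ⟨A eᵢ, C eᵢ⟩`. -/
instance : Inner ℝ (SelfAdjHS H) where
  inner A C := ∑' i, ⟪A.op (onb H i), C.op (onb H i)⟫

lemma SelfAdjHS.inner_coeffs (A C : SelfAdjHS H) : ⟪A.coeffs, C.coeffs⟫ = ⟪A, C⟫ :=
  lp.inner_eq_tsum _ _

instance : InnerProductSpace ℝ (SelfAdjHS H) where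
  norm_smul_le c A := by
    rw [← SelfAdjHS.norm_coeffs, ← SelfAdjHS.norm_coeffs, map_smul]; exact norm_smul_le _ _
  norm_sq_eq_re_inner A := by
    rw [← SelfAdjHS.norm_coeffs, ← SelfAdjHS.inner_coeffs]; exact norm_sq_eq_re_inner _
  conj_inner_symm A C := by
    simp only [← SelfAdjHS.inner_coeffs]; exact inner_conj_symm _ _
  add_left A C E := by
    simp only [← SelfAdjHS.inner_coeffs, map_add]; exact inner_add_left _ _ _
  smul_left A C r := by
    simp only [← SelfAdjHS.inner_coeffs, map_smul]; exact inner_smul_left _ _ _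

lemma SelfAdjHS.inner_eq_tsum (A C : SelfAdjHS H) :
    ⟪A, C⟫ = ∑' i, ⟪A.op (onb H i), C.op (onb H i)⟫ := rfl

lemma SelfAdjHS.norm_sq_eq (A : SelfAdjHS H) : ‖A‖ ^ 2 = ∑' i, ‖A.op (onb H i)‖ ^ 2 := by
  rw [← real_inner_self_eq_norm_sq, SelfAdjHS.inner_eq_tsum]
  simp

/-- The operator norm is at most the Hilbert-Schmidt norm. -/
lemma SelfAdjHS.norm_op_apply_le (A : SelfAdjHS H) (x : H) : ‖A.op x‖ ≤ ‖A‖ * ‖x‖ := by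
  refine le_of_sq_le_sq ?_ (by positivity)
  rw [← (hasSum_sq_inner (onb H) (A.op x)).tsum_eq, mul_pow, A.norm_sq_eq, ← tsum_mul_right]
  refine Summable.tsum_le_tsum (fun i => ?_) (hasSum_sq_inner _ _).summable
    (A.summable_op.mul_right _)
  rw [← A.inner_op, ← mul_pow]
  exact sq_le_sq' (by linarith [neg_le_of_abs_le (abs_real_inner_le_norm (A.op (onb H i)) x)])
    (real_inner_le_norm _ _)

lemma SelfAdjHS.norm_op_le (A : SelfAdjHS H) : ‖A.op‖ ≤ ‖A‖ :=
  ContinuousLinearMap.opNorm_le_bound _ (norm_nonneg _) A.norm_op_apply_le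

instance : CompleteSpace (SelfAdjHS H) := by
  refine Metric.complete_of_cauchySeq_tendsto fun v hv => ?_
  let opL : SelfAdjHS H →L[ℝ] (H →L[ℝ] H) :=
    SelfAdjHS.op.mkContinuous 1 fun A => by simpa using A.norm_op_le
  let coL : SelfAdjHS H →L[ℝ] lp (fun _ : OnbIndex H => H) 2 :=
    SelfAdjHS.coeffs.mkContinuous 1 fun A => by simp [SelfAdjHS.norm_coeffs]
  obtain ⟨A, hA⟩ := cauchySeq_tendsto_of_complete (opL.uniformContinuous.comp_cauchySeq hv)
  obtain ⟨f, hf⟩ := cauchySeq_tendsto_of_complete (coL.uniformContinuous.comp_cauchySeq hv)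
  have happ : ∀ x, Tendsto (fun n => (v n).op x) atTop (𝓝 (A x)) := fun x =>
    ((ContinuousLinearMap.apply ℝ H x).continuous.tendsto A).comp hA
  have hAf : ∀ i, A (onb H i) = f i := fun i => by
    refine tendsto_nhds_unique (happ (onb H i)) ?_
    exact (((lp.uniformContinuous_coe.continuous.tendsto f).comp hf).apply_nhds i)
  have hsa : IsSelfAdjoint A := by
    rw [ContinuousLinearMap.isSelfAdjoint_iff_isSymmetric]
    intro x y
    refine tendsto_nhds_unique ((happ x).inner tendsto_const_nhds) ?_
    refine ((tendsto_const_nhds (x := x)).inner (happ y)).congr fun n => ?_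
    exact ((v n).inner_op x y).symm
  have hsum : Summable fun i => ‖A (onb H i)‖ ^ 2 := by
    have := (memℓp_gen_iff (p := 2) (by simp)).1 f.2
    simpa [hAf] using this
  let a : SelfAdjHS H := ⟨A, hsa, hsum⟩
  have ha : a.coeffs = f := by
    ext i
    exact hAf i
  refine ⟨a, ?_⟩
  rw [tendsto_iff_norm_sub_tendsto_zero] at hf ⊢
  refine hf.congr fun n => ?_
  rw [← ha, ← SelfAdjHS.norm_coeffs, map_sub]
  rfl

lemma SelfAdjHS.hasSum_norm_sq_of_basis {ι : Type*} (f : HilbertBasis ι ℝ H)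
    (A : SelfAdjHS H) : HasSum (fun j => ‖A.op (f j)‖ ^ 2) (‖A‖ ^ 2) := by
  have key : ∑' j, ENNReal.ofReal (‖A.op (f j)‖ ^ 2) = ENNReal.ofReal (‖A‖ ^ 2) := by
    rw [A.norm_sq_eq, ENNReal.ofReal_tsum_of_nonneg (fun _ => by positivity) A.summable_op]
    have h1 : ∀ j, ENNReal.ofReal (‖A.op (f j)‖ ^ 2)
        = ∑' i, ENNReal.ofReal (⟪onb H i, A.op (f j)⟫ ^ 2) := fun j => by
      rw [← (hasSum_sq_inner (onb H) (A.op (f j))).tsum_eq,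
        ENNReal.ofReal_tsum_of_nonneg (fun _ => sq_nonneg _) (hasSum_sq_inner _ _).summable]
    have h2 : ∀ i, ENNReal.ofReal (‖A.op (onb H i)‖ ^ 2)
        = ∑' j, ENNReal.ofReal (⟪f j, A.op (onb H i)⟫ ^ 2) := fun i => by
      rw [← (hasSum_sq_inner f (A.op (onb H i))).tsum_eq,
        ENNReal.ofReal_tsum_of_nonneg (fun _ => sq_nonneg _) (hasSum_sq_inner _ _).summable]
    simp_rw [h1, h2]
    rw [ENNReal.tsum_comm]
    refine tsum_congr fun i => tsum_congr fun j => ?_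
    rw [← A.inner_op, real_inner_comm]
  have hne : ∑' j, ENNReal.ofReal (‖A.op (f j)‖ ^ 2) ≠ ⊤ := by
    rw [key]; exact ENNReal.ofReal_ne_top
  have hs := ENNReal.hasSum_toReal hne
  have e : ∀ j, (ENNReal.ofReal (‖A.op (f j)‖ ^ 2)).toReal = ‖A.op (f j)‖ ^ 2 :=
    fun j => ENNReal.toReal_ofReal (by positivity)
  rw [← ENNReal.tsum_toReal_eq (fun _ => ENNReal.ofReal_ne_top), key,
    ENNReal.toReal_ofReal (by positivity)] at hs
  simpa only [e] using hs

/-- The Hilbert-Schmidt inner product may be computed in any orthonormal basis. -/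
lemma SelfAdjHS.hasSum_inner_of_basis {ι : Type*} (f : HilbertBasis ι ℝ H)
    (A C : SelfAdjHS H) : HasSum (fun j => ⟪A.op (f j), C.op (f j)⟫) ⟪A, C⟫ := by
  have h := ((SelfAdjHS.hasSum_norm_sq_of_basis f (A + C)).sub
    (SelfAdjHS.hasSum_norm_sq_of_basis f (A - C))).mul_left (1 / 4)
  have e : ∀ {E : Type u} [NormedAddCommGroup E] [InnerProductSpace ℝ E] (x y : E),
      1 / 4 * (‖x + y‖ ^ 2 - ‖x - y‖ ^ 2) = ⟪x, y⟫ := fun x y => by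
    rw [norm_add_sq_real, norm_sub_sq_real]; ring
  simpa only [map_add, map_sub, _root_.add_apply, _root_.sub_apply, e]
    using h

end HilbertSchmidt

section Cone

variable (H : Type u) [NormedAddCommGroup H] [InnerProductSpace ℝ H] [CompleteSpace H]

/-- The cone `𝓗⁺` of positive operators in `𝓗`. -/
def posCone : Set (SelfAdjHS H) := {A | ∀ h : H, 0 ≤ ⟪A.op h, h⟫}

/-- The Borel σ-algebra of the Hilbert space `𝓗`. -/
instance : MeasurableSpace (SelfAdjHS H) := borel _

instance : BorelSpace (SelfAdjHS H) := ⟨rfl⟩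

/-- The punctured cone `𝓗⁺ \ {0}`, with its Borel σ-algebra. -/
abbrev PuncturedCone : Type u := {ξ : SelfAdjHS H // ξ ∈ posCone H ∧ ξ ≠ 0}

variable {H}

/-- The truncation function `χ(ξ) = ξ 1_{‖ξ‖ ≤ 1}`. -/
def chi (ξ : SelfAdjHS H) : SelfAdjHS H := if ‖ξ‖ ≤ 1 then ξ else 0

/-- The operator `a ⊗ a : h ↦ ⟨a, h⟩ a`, as an element of `𝓗`. -/
def tensorSq (a : H) : SelfAdjHS H :=
  ⟨InnerProductSpace.rankOne ℝ a a, by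
    rw [ContinuousLinearMap.isSelfAdjoint_iff_isSymmetric]
    intro x y
    simp [inner_smul_left, inner_smul_right, real_inner_comm, mul_comm], by
    simp only [InnerProductSpace.rankOne_apply, norm_smul, mul_pow, Real.norm_eq_abs, sq_abs]
    refine Summable.mul_right _ ?_
    simpa only [real_inner_comm] using (hasSum_sq_inner (onb H) a).summable⟩

lemma tensorSq_op (a h : H) : (tensorSq a).op h = ⟪a, h⟫ • a := rfl

end Cone

section VectorIntegral

variable {H : Type u} [NormedAddCommGroup H] [InnerProductSpace ℝ H] [CompleteSpace H]

/-- The signed measure `⟨μ(dξ), x⟩` for a vector measure `μ` with values in `𝓗`. -/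
def pairing (μ : VectorMeasure (PuncturedCone H) (SelfAdjHS H)) (x : SelfAdjHS H) :
    SignedMeasure (PuncturedCone H) :=
  μ.mapRange (innerSL ℝ x).toLinearMap.toAddMonoidHom (innerSL ℝ x).continuous

lemma pairing_apply (μ : VectorMeasure (PuncturedCone H) (SelfAdjHS H)) (x : SelfAdjHS H)
    (s : Set (PuncturedCone H)) : pairing μ x s = ⟪μ s, x⟫ := by
  rw [real_inner_comm]; rfl

/-- The integral of a real function against a signed measure, through the Jordan decomposition.
For a signed measure that is nonnegative this is the integral against a positive measure. -/
def signedIntegral {α : Type*} [MeasurableSpace α] (σ : SignedMeasure α) (g : α → ℝ) : ℝ :=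
  ∫ a, g a ∂σ.toJordanDecomposition.posPart - ∫ a, g a ∂σ.toJordanDecomposition.negPart

/-- `w` is the (weak) integral `∫ g(ξ) μ(dξ)` of the real function `g` against the vector measure
`μ`: for every `x ∈ 𝓗` the function `g` is integrable against `⟨μ(dξ), x⟩`, with integral
`⟨w, x⟩`. -/
def IsVectorIntegral (μ : VectorMeasure (PuncturedCone H) (SelfAdjHS H))
    (g : PuncturedCone H → ℝ) (w : SelfAdjHS H) : Prop :=
  ∀ x : SelfAdjHS H, Integrable g (pairing μ x).totalVariation ∧
    ⟪w, x⟫ = signedIntegral (pairing μ x) g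

lemma IsVectorIntegral.unique {μ : VectorMeasure (PuncturedCone H) (SelfAdjHS H)}
    {g : PuncturedCone H → ℝ} {w w' : SelfAdjHS H} (h : IsVectorIntegral μ g w)
    (h' : IsVectorIntegral μ g w') : w = w' :=
  ext_inner_right ℝ fun x => (h x).2.trans (h' x).2.symm

open Classical in
/-- The integral `∫ g(ξ) μ(dξ) ∈ 𝓗` of a real function against an `𝓗`-valued vector measure (it
exists for every bounded measurable `g`; where it does not exist the value is `0`). -/
def vectorIntegral (μ : VectorMeasure (PuncturedCone H) (SelfAdjHS H))
    (g : PuncturedCone H → ℝ) : SelfAdjHS H :=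
  if h : ∃ w, IsVectorIntegral μ g w then h.choose else 0

end VectorIntegral

section Parameters

variable (H : Type u) [NormedAddCommGroup H] [InnerProductSpace ℝ H] [CompleteSpace H]

/-- The data `(b, B, m, μ)`. -/
structure ParamSet where
  /-- the constant drift -/
  b : SelfAdjHS H
  /-- the linear drift -/
  B : SelfAdjHS H →L[ℝ] SelfAdjHS H
  /-- the constant jump measure, with values in `[0, ∞]` -/
  m : Measure (PuncturedCone H)
  /-- the state-dependent jump measure, with values in `𝓗` -/
  μ : VectorMeasure (PuncturedCone H) (SelfAdjHS H)

variable {H}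

/-- `(b, B, m, μ)` is an admissible parameter set. -/
structure ParamSet.IsAdmissible (p : ParamSet H) : Prop where
  b_mem : p.b ∈ posCone H
  m_second_moment : ∫⁻ ξ, ‖ξ.1‖ₑ ^ 2 ∂p.m < ⊤
  m_integrable : ∀ h : SelfAdjHS H, Integrable (fun ξ => ⟪chi ξ.1, h⟫) p.m
  m_mean : ∃ I : SelfAdjHS H, ∀ h : SelfAdjHS H, ⟪I, h⟫ = ∫ ξ, ⟪chi ξ.1, h⟫ ∂p.m
  b_ge : ∀ v ∈ posCone H, 0 ≤ ⟪p.b, v⟫ - ∫ ξ, ⟪chi ξ.1, v⟫ ∂p.m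
  μ_mem : ∀ s, MeasurableSet s → p.μ s ∈ posCone H
  μ_integrable : ∀ u ∈ posCone H, ∀ x ∈ posCone H, ⟪u, x⟫ = 0 →
    Integrable (fun ξ => ⟪chi ξ.1, u⟫ / ‖ξ.1‖ ^ 2) (pairing p.μ x).totalVariation
  B_quasiMonotone : ∀ u ∈ posCone H, ∀ x ∈ posCone H, ⟪u, x⟫ = 0 →
    0 ≤ ⟪ContinuousLinearMap.adjoint p.B u, x⟫
      - signedIntegral (pairing p.μ x) (fun ξ => ⟪chi ξ.1, u⟫ / ‖ξ.1‖ ^ 2)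

end Parameters

section Complexification

variable (H : Type u) [NormedAddCommGroup H] [InnerProductSpace ℝ H] [CompleteSpace H]

/-- The complexification `H + iH`; the pair `(x, y)` stands for `x + iy`, and
`‖x + iy‖² = ‖x‖² + ‖y‖²`. -/
abbrev Cx : Type u := WithLp 2 (H × H)

/-- The subspace `iH` of `H + iH`. -/
def imagSpace : Set (Cx H) := {z | z.fst = 0}

variable {H}

/-- The inclusion of `H` in `H + iH`. -/
def ofReal (x : H) : Cx H := WithLp.toLp 2 (x, 0)

/-- Multiplication by the imaginary unit, `i(x + iy) = -y + ix`. -/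
def mulI (z : Cx H) : Cx H := WithLp.toLp 2 (-z.snd, z.fst)

/-- The complex linear extension of a bounded operator on `H`. -/
def cxMap (C : H →L[ℝ] H) (z : Cx H) : Cx H := WithLp.toLp 2 (C z.fst, C z.snd)

/-- The real part `x ⊗ x - y ⊗ y` of `z ⊗ z`, `z = x + iy`, for the complex bilinear extension of
the tensor product. The imaginary part `x ⊗ y + y ⊗ x` vanishes for `z ∈ iH`. -/
def cxTensorSq (z : Cx H) : SelfAdjHS H := tensorSq z.fst - tensorSq z.snd

end Complexification

section Operators

variable {H : Type u} [NormedAddCommGroup H] [InnerProductSpace ℝ H] [CompleteSpace H]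

open Classical in
/-- The positive square root `D^{1/2}` of a positive self-adjoint operator `D`: the unique positive
self-adjoint operator whose square is `D`. -/
def posSqrt (D : H →L[ℝ] H) : H →L[ℝ] H :=
  if h : ∃ C : H →L[ℝ] H, C.IsPositive ∧ C ∘L C = D then h.choose else 0

/-- `(S(t))_{t ≥ 0}` is a strongly continuous semigroup on `H`. -/
structure IsC0Semigroup (S : ℝ → H →L[ℝ] H) : Prop where
  zero : S 0 = ContinuousLinearMap.id ℝ H
  add : ∀ s t : ℝ, 0 ≤ s → 0 ≤ t → S (s + t) = S s ∘L S t
  continuousOn : ∀ x, ContinuousOn (fun t => S t x) (Ici 0)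

/-- `𝓐` (with its domain) is the generator of `(S(t))_{t ≥ 0}`. -/
def IsGeneratorOf (𝓐 : H →ₗ.[ℝ] H) (S : ℝ → H →L[ℝ] H) : Prop :=
  ∀ x y : H, (∃ hx : x ∈ 𝓐.domain, 𝓐 ⟨x, hx⟩ = y) ↔
    Tendsto (fun t : ℝ => t⁻¹ • (S t x - x)) (𝓝[>] 0) (𝓝 y)

/-- `𝓐` is the generator of a strongly continuous semigroup. -/
def IsC0Generator (𝓐 : H →ₗ.[ℝ] H) : Prop :=
  ∃ S : ℝ → H →L[ℝ] H, IsC0Semigroup S ∧ IsGeneratorOf 𝓐 S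

/-- The bounded operator `R` is the inverse `(r I - 𝓐)⁻¹` of `r I - 𝓐 : dom 𝓐 → H`. -/
def IsResolventAt (𝓐 : H →ₗ.[ℝ] H) (r : ℝ) (R : H →L[ℝ] H) : Prop :=
  (∀ x : H, ∃ hx : R x ∈ 𝓐.domain, r • R x - 𝓐 ⟨R x, hx⟩ = x) ∧
    ∀ x : 𝓐.domain, R (r • (x : H) - 𝓐 x) = x

open Classical in
/-- The resolvent `(r I - 𝓐)⁻¹` (and `0` if `r` is not in the resolvent set of `𝓐`). -/
def resolventAt (𝓐 : H →ₗ.[ℝ] H) (r : ℝ) : H →L[ℝ] H :=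
  if h : ∃ R, IsResolventAt 𝓐 r R then h.choose else 0

/-- The Yosida approximation `𝓐⁽ⁿ⁾ = n 𝓐 (n I - 𝓐)⁻¹`. For the generator of a strongly continuous
semigroup and all large `n`, the number `n` is in the resolvent set, and the domain of `𝓐⁽ⁿ⁾` is
all of `H`. -/
def yosida (𝓐 : H →ₗ.[ℝ] H) (n : ℕ) : H →ₗ.[ℝ] H where
  domain := 𝓐.domain.comap (resolventAt 𝓐 n).toLinearMap
  toFun := (n : ℝ) • 𝓐.toFun ∘ₗ
    (resolventAt 𝓐 n).toLinearMap.restrict (fun _ hx => hx)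

lemma yosida_apply (𝓐 : H →ₗ.[ℝ] H) (n : ℕ) (x : (yosida 𝓐 n).domain) :
    yosida 𝓐 n x = (n : ℝ) • 𝓐 ⟨resolventAt 𝓐 n (x : H), x.2⟩ := rfl

end Operators

section Riccati

variable {H : Type u} [NormedAddCommGroup H] [InnerProductSpace ℝ H] [CompleteSpace H]

/-- `K(ξ, u) = e^{-⟨ξ, u⟩} - 1 + ⟨χ(ξ), u⟩`. -/
def jumpKernel (ξ u : SelfAdjHS H) : ℝ := Real.exp (-⟪ξ, u⟫) - 1 + ⟪chi ξ, u⟫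

/-- `F(u) = ⟨b, u⟩ - ∫ K(ξ, u) m(dξ)`. -/
def riccatiF (p : ParamSet H) (u : SelfAdjHS H) : ℝ :=
  ⟪p.b, u⟫ - ∫ ξ, jumpKernel ξ.1 u ∂p.m

/-- `R(h, u) = B*(u) - ½ D^{1/2}h ⊗ D^{1/2}h - ∫ K(ξ, u) μ(dξ) / ‖ξ‖²` for `h ∈ iH`. -/
def riccatiR (p : ParamSet H) (D : H →L[ℝ] H) (h : Cx H) (u : SelfAdjHS H) : SelfAdjHS H :=
  ContinuousLinearMap.adjoint p.B u - (1 / 2 : ℝ) • cxTensorSq (cxMap (posSqrt D) h)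
    - vectorIntegral p.μ (fun ξ => jumpKernel ξ.1 u / ‖ξ.1‖ ^ 2)

/-- `(Φ, ψ₁, ψ₂)` is a mild solution on `[0, T]` of the generalised Riccati equations
`Φ' = F(ψ₂)`, `ψ₁(t) = u₁ - i 𝓐*(i ∫₀ᵗ ψ₁(s) ds)`, `ψ₂' = R(ψ₁, ψ₂)` on `(0, T]` with initial value
`Φ(0) = 0`, `ψ₁(0) = u₁`, `ψ₂(0) = u₂`. It is part of the second equation that the vector
`i ∫₀ᵗ ψ₁(s) ds ∈ H` lies in the domain of `𝓐*`. -/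
structure IsMildSolution (p : ParamSet H) (𝓐 : H →ₗ.[ℝ] H) (D : H →L[ℝ] H) (T : ℝ)
    (u₁ : Cx H) (u₂ : SelfAdjHS H) (Φ : ℝ → ℝ) (ψ₁ : ℝ → Cx H) (ψ₂ : ℝ → SelfAdjHS H) :
    Prop where
  contDiff_Φ : ContDiffOn ℝ 1 Φ (Icc 0 T)
  Φ_nonneg : ∀ t ∈ Icc 0 T, 0 ≤ Φ t
  continuous_ψ₁ : ContinuousOn ψ₁ (Icc 0 T)
  ψ₁_mem : ∀ t ∈ Icc 0 T, ψ₁ t ∈ imagSpace H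
  contDiff_ψ₂ : ContDiffOn ℝ 1 ψ₂ (Icc 0 T)
  ψ₂_mem : ∀ t ∈ Icc 0 T, ψ₂ t ∈ posCone H
  Φ_zero : Φ 0 = 0
  ψ₁_zero : ψ₁ 0 = u₁
  ψ₂_zero : ψ₂ 0 = u₂
  Φ_eq : ∀ t ∈ Ioc 0 T, HasDerivWithinAt Φ (riccatiF p (ψ₂ t)) (Icc 0 T) t
  ψ₁_eq : ∀ t ∈ Ioc 0 T, ∃ ht : (mulI (∫ s in (0 : ℝ)..t, ψ₁ s)).fst ∈ 𝓐.adjoint.domain,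
    ψ₁ t = u₁ - mulI (ofReal (𝓐.adjoint ⟨(mulI (∫ s in (0 : ℝ)..t, ψ₁ s)).fst, ht⟩))
  ψ₂_eq : ∀ t ∈ Ioc 0 T, HasDerivWithinAt ψ₂ (riccatiR p D (ψ₁ t) (ψ₂ t)) (Icc 0 T) t

end Riccati

end YosidaRiccati

end

/-!
Write `ψ₁ = i v` with `v : [0, T] → H`. The equation for `ψ₁` is the mild form of `v' = 𝓐* v`, so it
does not involve `ψ₂`, and the one for `ψ₂` is an ordinary differential equation driven by `ψ₁`. The
convergence is shown for `ψ₁`, then for `ψ₂`, then for `Φ`.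

For `ψ₁`, the approximation solves `vₙ' = Aₙ* vₙ` with the bounded operator `Aₙ* = n² Rₙ* - n`,
`Rₙ = (n - 𝓐)⁻¹`. The bounds `‖Rₙᵏ‖ ≤ M (n - ω)⁻ᵏ` (`IsC0Semigroup.norm_laplace_pow_le`) bound
`‖e^{t Aₙ*}‖` uniformly in `n` and `t ∈ [0, T]`. No adjoint semigroup is needed: a mild solution `v`
is regularised to `P v`, where `P = R_k*` for a fixed large `k`. This is a `C¹` function with derivative
`Q v`, `Q = k P - 1`, and by the resolvent identity `d = P (vₙ - v)` solves
`d' = Aₙ* d + (n Rₙ* - 1) Q v`. Since `n Rₙ* → 1` strongly, hence uniformly on the compact set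
`Q v([0, T])`, Duhamel's estimate gives `d → 0` uniformly. Finally `k P v - v` and `k P vₙ - vₙ` are
small for large `k`, the latter uniformly in `n` as it is `e^{t Aₙ*} (k P v(0) - v(0))`. This is
`IsC0Generator.eventually_norm_sub_le`.

For `ψ₂`, the map `R` is Lipschitz on bounded subsets of `iH × 𝓗⁺` (`exists_lipschitz_riccatiR`):
because `⟪ξ, u⟫ ≥ 0` for positive `ξ`, `u`, the increments of `K(ξ, u) / ‖ξ‖²` in `u` are bounded
uniformly in `ξ`, and the integral of bounded functions against a vector measure is continuous for the
supremum norm. A Gronwall argument (`norm_le_of_norm_deriv_le_local`) that asks for the Lipschitz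
estimate only while `‖ψ₂ⁿ - ψ₂‖ ≤ 1` makes an a priori bound on `ψ₂ⁿ` unnecessary. Convergence of `Φ`
follows by integration, as `F` is locally Lipschitz too.
-/

namespace YosidaRiccati

set_option linter.unusedSectionVars false

/-! ### Strongly continuous semigroups and their resolvents -/

section Semigroup

variable {H : Type*} [NormedAddCommGroup H] [InnerProductSpace ℝ H] [CompleteSpace H]
  {S : ℝ → H →L[ℝ] H}

/-- A strongly continuous semigroup is exponentially bounded. -/
lemma IsC0Semigroup.exists_norm_le_exp (hS : IsC0Semigroup S) :
    ∃ M ω : ℝ, 1 ≤ M ∧ 0 ≤ ω ∧ ∀ t, 0 ≤ t → ‖S t‖ ≤ M * Real.exp (ω * t) := by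
  obtain ⟨C, hC⟩ := banach_steinhaus (g := fun t : Icc (0 : ℝ) 1 => S t) (fun x => by
    obtain ⟨C, hC⟩ := isCompact_Icc.exists_bound_of_continuousOn
      ((hS.continuousOn x).mono (Icc_subset_Ici_self : Icc (0 : ℝ) 1 ⊆ Ici 0))
    exact ⟨C, fun t => hC t t.2⟩)
  set M := max C 1
  have hM1 : 1 ≤ M := le_max_right _ _
  have hM0 : 0 < M := by linarith
  have hM : ∀ r ∈ Icc (0 : ℝ) 1, ‖S r‖ ≤ M := fun r hr => (hC ⟨r, hr⟩).trans (le_max_left _ _)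
  have hpow : ∀ n : ℕ, ∀ r ∈ Icc (0 : ℝ) 1, ‖S (n + r)‖ ≤ M * M ^ n := by
    intro n
    induction n with
    | zero => intro r hr; simpa using hM r hr
    | succ n ih =>
      intro r hr
      have e : ((n + 1 : ℕ) : ℝ) + r = 1 + (n + r) := by push_cast; ring
      rw [e, hS.add 1 _ zero_le_one (by have := hr.1; positivity)]
      calc ‖S 1 ∘L S (n + r)‖ ≤ ‖S 1‖ * ‖S (n + r)‖ := ContinuousLinearMap.opNorm_comp_le _ _
        _ ≤ M * (M * M ^ n) := by
          gcongr
          exacts [hM 1 ⟨zero_le_one, le_rfl⟩, ih r hr]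
        _ = M * M ^ (n + 1) := by ring
  refine ⟨M, Real.log M, hM1, Real.log_nonneg hM1, fun t ht => ?_⟩
  have hfl : (⌊t⌋₊ : ℝ) ≤ t := Nat.floor_le ht
  have h1 := hpow ⌊t⌋₊ (t - ⌊t⌋₊) ⟨by linarith, by linarith [Nat.lt_floor_add_one t]⟩
  rw [add_sub_cancel] at h1
  refine h1.trans ?_
  gcongr
  rw [← Real.rpow_natCast, Real.rpow_def_of_pos hM0]
  have := Real.log_nonneg hM1
  gcongr

variable {M ω l : ℝ}

lemma IsC0Semigroup.norm_laplace_integrand_le (hb : ∀ t, 0 ≤ t → ‖S t‖ ≤ M * Real.exp (ω * t))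
    (x : H) {s : ℝ} (hs : 0 ≤ s) :
    ‖Real.exp (-l * s) • S s x‖ ≤ M * ‖x‖ * Real.exp (-(l - ω) * s) := by
  rw [norm_smul, Real.norm_eq_abs, Real.abs_exp]
  calc Real.exp (-l * s) * ‖S s x‖ ≤ Real.exp (-l * s) * (M * Real.exp (ω * s) * ‖x‖) := by
        gcongr; exact (S s).le_of_opNorm_le (hb s hs) x
    _ = M * ‖x‖ * (Real.exp (-l * s) * Real.exp (ω * s)) := by ring
    _ = _ := by rw [← Real.exp_add]; ring_nf

lemma IsC0Semigroup.integrableOn_laplace (hS : IsC0Semigroup S)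
    (hb : ∀ t, 0 ≤ t → ‖S t‖ ≤ M * Real.exp (ω * t)) (hl : ω < l) (x : H) :
    IntegrableOn (fun s => Real.exp (-l * s) • S s x) (Ioi 0) := by
  refine Integrable.mono' ((integrableOn_exp_mul_Ioi (a := -(l - ω)) (by linarith) 0).const_mul
    (M * ‖x‖)) ?_ ?_
  · refine ContinuousOn.aestronglyMeasurable ?_ measurableSet_Ioi
    exact (by fun_prop : Continuous fun s : ℝ => Real.exp (-l * s)).continuousOn.smul
      ((hS.continuousOn x).mono Ioi_subset_Ici_self)
  · filter_upwards [ae_restrict_mem measurableSet_Ioi] with s hs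
    exact norm_laplace_integrand_le hb x (le_of_lt hs)

/-- The Laplace transform `∫₀^∞ e^{-ls} S(s) x ds`, which is the resolvent of the generator. -/
noncomputable def laplace (S : ℝ → H →L[ℝ] H) (l : ℝ) (x : H) : H :=
  ∫ s in Ioi (0 : ℝ), Real.exp (-l * s) • S s x

/-- Integrating an exponential bound on the orbit of `x` gains a factor `(l - ω)⁻¹`. -/
lemma norm_laplace_le_of_bound (hl : ω < l) {x : H} {C : ℝ}
    (hx : ∀ s, 0 ≤ s → ‖S s x‖ ≤ C * Real.exp (ω * s)) : ‖laplace S l x‖ ≤ C / (l - ω) := by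
  have h1 := norm_integral_le_of_norm_le (f := fun s => Real.exp (-l * s) • S s x)
    ((integrableOn_exp_mul_Ioi (a := -(l - ω)) (by linarith) 0).const_mul C) (by
      filter_upwards [ae_restrict_mem measurableSet_Ioi] with s hs
      rw [norm_smul, Real.norm_eq_abs, Real.abs_exp]
      calc Real.exp (-l * s) * ‖S s x‖ ≤ Real.exp (-l * s) * (C * Real.exp (ω * s)) := by
            gcongr; exact hx s (le_of_lt hs)
        _ = C * (Real.exp (-l * s) * Real.exp (ω * s)) := by ring
        _ = _ := by rw [← Real.exp_add]; ring_nf)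
  refine h1.trans_eq ?_
  rw [integral_const_mul, integral_exp_mul_Ioi (by linarith)]
  simp only [mul_zero, Real.exp_zero]
  have : l - ω ≠ 0 := by linarith
  field_simp

lemma IsC0Semigroup.exists_laplace_clm (hS : IsC0Semigroup S)
    (hb : ∀ t, 0 ≤ t → ‖S t‖ ≤ M * Real.exp (ω * t)) (hl : ω < l) :
    ∃ R : H →L[ℝ] H, ∀ x, R x = laplace S l x := by
  refine ⟨LinearMap.mkContinuous
    { toFun := laplace S l
      map_add' := fun x y => ?_
      map_smul' := fun c x => ?_ } (M / (l - ω)) fun x => ?_, fun x => rfl⟩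
  · simp only [laplace, map_add, smul_add]
    exact integral_add (hS.integrableOn_laplace hb hl x) (hS.integrableOn_laplace hb hl y)
  · simp only [laplace, map_smul, RingHom.id_apply, ← integral_smul]
    simp only [smul_comm c]
  · have := norm_laplace_le_of_bound (S := S) (x := x) (C := M * ‖x‖) hl fun s hs =>
      ((S s).le_of_opNorm_le (hb s hs) x).trans_eq (by ring)
    exact this.trans_eq (by ring)

lemma IsC0Semigroup.apply_laplace (hS : IsC0Semigroup S)
    (hb : ∀ t, 0 ≤ t → ‖S t‖ ≤ M * Real.exp (ω * t)) (hl : ω < l) (x : H) {t : ℝ} (ht : 0 ≤ t) :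
    S t (laplace S l x) = laplace S l (S t x) := by
  rw [laplace, laplace, ← (S t).integral_comp_comm (hS.integrableOn_laplace hb hl x)]
  refine setIntegral_congr_fun measurableSet_Ioi fun s hs => ?_
  have hs' : 0 ≤ s := le_of_lt hs
  simp only [map_smul]
  rw [← ContinuousLinearMap.comp_apply, ← hS.add t s ht hs', add_comm, hS.add s t hs' ht,
    ContinuousLinearMap.comp_apply]

/-- The shift identity `S(h) R x = e^{lh} (R x - ∫₀ʰ e^{-ls} S(s) x ds)`. -/
lemma IsC0Semigroup.apply_laplace_eq (hS : IsC0Semigroup S)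
    (hb : ∀ t, 0 ≤ t → ‖S t‖ ≤ M * Real.exp (ω * t)) (hl : ω < l) (x : H) {h : ℝ} (hh : 0 ≤ h) :
    S h (laplace S l x)
      = Real.exp (l * h) • (laplace S l x - ∫ s in (0 : ℝ)..h, Real.exp (-l * s) • S s x) := by
  have hi := hS.integrableOn_laplace hb hl x
  rw [laplace, ← intervalIntegral.integral_Ioi_sub_Ioi hi hh, sub_sub_cancel,
    ← (S h).integral_comp_comm hi, ← integral_smul]
  have hpre : (fun s : ℝ => s + h) ⁻¹' Ioi h = Ioi 0 := by ext s; simp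
  rw [← (measurePreserving_add_right volume h).setIntegral_preimage_emb
    (measurableEmbedding_addRight h) _ (Ioi h), hpre]
  refine setIntegral_congr_fun measurableSet_Ioi fun s hs => ?_
  have hs' : 0 ≤ s := le_of_lt hs
  simp only [map_smul]
  rw [smul_smul, ← Real.exp_add, add_comm s h, hS.add h s hh hs', ContinuousLinearMap.comp_apply]
  ring_nf

lemma tendsto_slope_exp (l : ℝ) :
    Tendsto (fun h : ℝ => h⁻¹ * (Real.exp (l * h) - 1)) (𝓝[>] 0) (𝓝 l) := by
  have : HasDerivAt (fun h : ℝ => Real.exp (l * h)) l 0 := by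
    simpa using ((hasDerivAt_id (0 : ℝ)).const_mul l).exp
  have h := (hasDerivAt_iff_tendsto_slope_zero.1 this).mono_left
    (nhdsWithin_mono 0 fun a (ha : a ∈ Ioi (0 : ℝ)) => ne_of_gt ha)
  simpa using h

lemma IsC0Semigroup.tendsto_slope_laplace (hS : IsC0Semigroup S)
    (hb : ∀ t, 0 ≤ t → ‖S t‖ ≤ M * Real.exp (ω * t)) (hl : ω < l) (x : H) :
    Tendsto (fun h : ℝ => h⁻¹ • (S h (laplace S l x) - laplace S l x)) (𝓝[>] 0)
      (𝓝 (l • laplace S l x - x)) := by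
  set y := laplace S l x
  have hexp := tendsto_slope_exp l
  have hcont : ContinuousOn (fun s : ℝ => Real.exp (-l * s) • S s x) (Ici 0) :=
    (by fun_prop : Continuous fun s : ℝ => Real.exp (-l * s)).continuousOn.smul (hS.continuousOn x)
  have hint : Tendsto (fun h : ℝ => h⁻¹ • ∫ s in (0 : ℝ)..h, Real.exp (-l * s) • S s x) (𝓝[>] 0)
      (𝓝 x) := by
    have hd : HasDerivWithinAt (fun h : ℝ => ∫ s in (0 : ℝ)..h, Real.exp (-l * s) • S s x)
        (Real.exp (-l * 0) • S 0 x) (Ici 0) 0 := by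
      refine intervalIntegral.integral_hasDerivWithinAt_right (t := Ioi 0) (by simp) ?_ ?_
      · exact ⟨Ioi 0, self_mem_nhdsWithin, (hcont.mono Ioi_subset_Ici_self).aestronglyMeasurable
          measurableSet_Ioi⟩
      · exact (hcont 0 self_mem_Ici).mono Ioi_subset_Ici_self
    have := (hasDerivWithinAt_iff_tendsto_slope' (by simp)).1 hd.Ioi_of_Ici
    simp only [mul_zero, Real.exp_zero, one_smul, hS.zero, ContinuousLinearMap.id_apply] at this
    exact this.congr fun h => by simp [slope_def_module]
  have hexp1 : Tendsto (fun h : ℝ => Real.exp (l * h)) (𝓝[>] 0) (𝓝 1) := by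
    have : Continuous fun h : ℝ => Real.exp (l * h) := by fun_prop
    simpa using (this.tendsto 0).mono_left nhdsWithin_le_nhds
  have := (hexp.smul_const y).sub (hexp1.smul hint)
  rw [one_smul] at this
  refine this.congr' ?_
  filter_upwards [self_mem_nhdsWithin] with h hh
  rw [hS.apply_laplace_eq hb hl x (le_of_lt hh)]
  module

variable {𝓐 : H →ₗ.[ℝ] H}

/-- The Laplace transform of the semigroup is the resolvent of its generator. -/
lemma IsGeneratorOf.isResolventAt (hA : IsGeneratorOf 𝓐 S) (hS : IsC0Semigroup S)
    (hb : ∀ t, 0 ≤ t → ‖S t‖ ≤ M * Real.exp (ω * t)) (hl : ω < l) {R : H →L[ℝ] H}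
    (hR : ∀ x, R x = laplace S l x) : IsResolventAt 𝓐 l R := by
  constructor
  · intro x
    obtain ⟨hx, hy⟩ := (hA (R x) (l • R x - x)).2 (by
      simpa only [hR] using hS.tendsto_slope_laplace hb hl x)
    exact ⟨hx, by rw [hy, sub_sub_cancel]⟩
  · rintro ⟨x, hx⟩
    have h1 := (hA x (𝓐 ⟨x, hx⟩)).1 ⟨hx, rfl⟩
    have h2 := (R.continuous.tendsto _).comp h1
    have h3 : Tendsto (fun t : ℝ => R (t⁻¹ • (S t x - x))) (𝓝[>] 0) (𝓝 (l • R x - x)) := by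
      rw [hR x]
      refine (hS.tendsto_slope_laplace hb hl x).congr' ?_
      filter_upwards [self_mem_nhdsWithin] with t ht
      rw [hS.apply_laplace hb hl x (le_of_lt ht), map_smul, map_sub, hR, hR]
    have := tendsto_nhds_unique h2 h3
    rw [map_sub, map_smul, this, sub_sub_cancel]

/-- The vector `h⁻¹ (e^{lh} R x - S(h) R x)` lies in the domain and tends to `x`. -/
lemma IsGeneratorOf.dense_domain (hA : IsGeneratorOf 𝓐 S) (hS : IsC0Semigroup S) :
    Dense (𝓐.domain : Set H) := by
  obtain ⟨M, ω, -, -, hb⟩ := hS.exists_norm_le_exp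
  have hl : ω < ω + 1 := by linarith
  obtain ⟨R, hR⟩ := hS.exists_laplace_clm hb hl
  have hres := hA.isResolventAt hS hb hl hR
  intro x
  have h1 := ((tendsto_slope_exp (ω + 1)).smul_const (R x)).sub (hS.tendsto_slope_laplace hb hl x)
  rw [hR, sub_sub_cancel] at h1
  refine mem_closure_of_tendsto h1 ?_
  filter_upwards [self_mem_nhdsWithin] with h hh
  rw [hS.apply_laplace hb hl x (le_of_lt hh), ← hR, ← hR]
  obtain ⟨hx, -⟩ := hres.1 x
  obtain ⟨hx', -⟩ := hres.1 (S h x)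
  exact Submodule.sub_mem _ (Submodule.smul_mem _ _ hx)
    (Submodule.smul_mem _ _ (Submodule.sub_mem _ hx' hx))

/-- The Hille-Yosida estimate: the powers of the resolvent are bounded by `M (l - ω)⁻ᵏ`, with one
constant `M` for all powers. It is proved for `S(t) Rᵏ` by induction on `k`. -/
lemma IsC0Semigroup.norm_laplace_pow_le (hS : IsC0Semigroup S)
    (hb : ∀ t, 0 ≤ t → ‖S t‖ ≤ M * Real.exp (ω * t)) (hl : ω < l) {R : H →L[ℝ] H}
    (hR : ∀ x, R x = laplace S l x) (k : ℕ) : ‖R ^ k‖ ≤ M / (l - ω) ^ k := by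
  have hM : 0 ≤ M := by simpa using (norm_nonneg _).trans (hb 0 le_rfl)
  have hlω : 0 < l - ω := by linarith
  have key : ∀ k : ℕ, ∀ x t, 0 ≤ t →
      ‖S t ((R ^ k) x)‖ ≤ M / (l - ω) ^ k * ‖x‖ * Real.exp (ω * t) := by
    intro k
    induction k with
    | zero =>
      intro x t ht
      simpa [mul_right_comm] using (S t).le_of_opNorm_le (hb t ht) x
    | succ k ih =>
      intro x t ht
      rw [pow_succ', mul_apply_eq_comp, hR, hS.apply_laplace hb hl _ ht]
      refine (norm_laplace_le_of_bound (C := M / (l - ω) ^ k * ‖x‖ * Real.exp (ω * t)) hl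
        fun s hs => ?_).trans_eq (by rw [pow_succ]; field_simp)
      rw [← ContinuousLinearMap.comp_apply, ← hS.add s t hs ht]
      refine (ih x (s + t) (by positivity)).trans_eq ?_
      rw [mul_add, Real.exp_add]
      ring
  refine ContinuousLinearMap.opNorm_le_bound _ (by positivity) fun x => ?_
  simpa [hS.zero] using key k x 0 le_rfl

lemma IsResolventAt.unique {R R' : H →L[ℝ] H} (h : IsResolventAt 𝓐 l R)
    (h' : IsResolventAt 𝓐 l R') : R = R' := by
  ext x
  obtain ⟨hx, e⟩ := h'.1 x
  have := h.2 ⟨R' x, hx⟩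
  rw [e] at this
  exact this

lemma IsResolventAt.resolventAt_eq {R : H →L[ℝ] H} (h : IsResolventAt 𝓐 l R) :
    resolventAt 𝓐 l = R := by
  have hex : ∃ R, IsResolventAt 𝓐 l R := ⟨R, h⟩
  rw [resolventAt, dif_pos hex]
  exact hex.choose_spec.unique h

/-- The easy half of the Hille-Yosida theorem. -/
lemma IsC0Generator.hille_yosida (hA : IsC0Generator 𝓐) :
    ∃ M ω : ℝ, 1 ≤ M ∧ 0 ≤ ω ∧ ∀ l, ω < l → IsResolventAt 𝓐 l (resolventAt 𝓐 l) ∧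
      ∀ k : ℕ, ‖resolventAt 𝓐 l ^ k‖ ≤ M / (l - ω) ^ k := by
  obtain ⟨S, hS, hA⟩ := hA
  obtain ⟨M, ω, hM, hω, hb⟩ := hS.exists_norm_le_exp
  refine ⟨M, ω, hM, hω, fun l hl => ?_⟩
  obtain ⟨R, hR⟩ := hS.exists_laplace_clm hb hl
  have hres := hA.isResolventAt hS hb hl hR
  rw [hres.resolventAt_eq]
  exact ⟨hres, hS.norm_laplace_pow_le hb hl hR⟩

lemma IsC0Generator.dense_domain (hA : IsC0Generator 𝓐) : Dense (𝓐.domain : Set H) := by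
  obtain ⟨S, hS, hA⟩ := hA
  exact hA.dense_domain hS

end Semigroup

/-! ### Linear evolution equations with bounded generator -/

section Evolution

variable {E : Type*} [NormedAddCommGroup E] [NormedSpace ℝ E] [CompleteSpace E]

/-- Power series estimate: resolvent-type bounds on the powers of `R` bound `e^{aR}`. -/
lemma norm_exp_smul_le {R : E →L[ℝ] E} {M q : ℝ} (hR : ∀ k : ℕ, ‖R ^ k‖ ≤ M * q ^ k)
    {a : ℝ} (ha : 0 ≤ a) : ‖NormedSpace.exp (a • R)‖ ≤ M * Real.exp (a * q) := by
  have hs : HasSum (fun k : ℕ => M * ((k.factorial : ℝ)⁻¹ * (a * q) ^ k)) (M * Real.exp (a * q)) := by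
    rw [Real.exp_eq_exp_ℝ]
    refine HasSum.mul_left _ ?_
    simpa using NormedSpace.exp_series_hasSum_exp' (𝕂 := ℝ) (a * q)
  rw [NormedSpace.exp_eq_tsum ℝ]
  refine tsum_of_norm_bounded hs fun k => ?_
  rw [smul_pow, norm_smul, norm_smul, Real.norm_of_nonneg (by positivity),
    Real.norm_of_nonneg (by positivity)]
  calc (k.factorial : ℝ)⁻¹ * (a ^ k * ‖R ^ k‖) ≤ (k.factorial : ℝ)⁻¹ * (a ^ k * (M * q ^ k)) := by
        gcongr; exact hR k
    _ = _ := by rw [mul_pow]; ring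

lemma norm_exp_smul_sub_le {R : E →L[ℝ] E} {M q : ℝ} (hR : ∀ k : ℕ, ‖R ^ k‖ ≤ M * q ^ k)
    {a c t : ℝ} (ha : 0 ≤ a) (ht : 0 ≤ t) :
    ‖NormedSpace.exp (t • (a • R - c • (1 : E →L[ℝ] E)))‖ ≤ M * Real.exp (t * (a * q - c)) := by
  let _ : NormedAlgebra ℚ (E →L[ℝ] E) := NormedAlgebra.restrictScalars ℚ ℝ _
  have hc : Commute ((-(t * c)) • (1 : E →L[ℝ] E)) ((t * a) • R) :=
    ((Commute.one_left R).smul_left _).smul_right _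
  have e : t • (a • R - c • (1 : E →L[ℝ] E)) = (-(t * c)) • (1 : E →L[ℝ] E) + (t * a) • R := by
    module
  have h1 : ‖NormedSpace.exp ((-(t * c)) • (1 : E →L[ℝ] E))‖ ≤ 1 * Real.exp (-(t * c)) := by
    have : NormedSpace.exp ((-(t * c)) • (1 : E →L[ℝ] E))
        = Real.exp (-(t * c)) • (1 : E →L[ℝ] E) := by
      rw [← Algebra.algebraMap_eq_smul_one, ← Algebra.algebraMap_eq_smul_one, Real.exp_eq_exp_ℝ,
        NormedSpace.algebraMap_exp_comm]
    rw [this, norm_smul, Real.norm_eq_abs, Real.abs_exp, mul_comm]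
    gcongr
    exact ContinuousLinearMap.norm_id_le
  rw [e, NormedSpace.exp_add_of_commute hc]
  calc _ ≤ ‖NormedSpace.exp ((-(t * c)) • (1 : E →L[ℝ] E))‖ * ‖NormedSpace.exp ((t * a) • R)‖ :=
        norm_mul_le _ _
    _ ≤ 1 * Real.exp (-(t * c)) * (M * Real.exp (t * a * q)) := by
        gcongr
        exact norm_exp_smul_le hR (by positivity)
    _ = M * (Real.exp (-(t * c)) * Real.exp (t * a * q)) := by ring
    _ = _ := by rw [← Real.exp_add]; ring_nf

/-- Duhamel's estimate for `d' = C d + f`: if `‖e^{sC}‖ ≤ K` and `‖f‖ ≤ ε` on `[0, T]`, then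
`‖d(t)‖ ≤ K (‖d(0)‖ + ε T)`. -/
lemma norm_le_of_hasDerivWithinAt_linear {C : E →L[ℝ] E} {T K ε : ℝ} {d f : ℝ → E}
    (hK : ∀ s ∈ Icc 0 T, ‖NormedSpace.exp (s • C)‖ ≤ K)
    (hd : ∀ s ∈ Icc 0 T, HasDerivWithinAt d (C (d s) + f s) (Icc 0 T) s)
    (hf : ∀ s ∈ Icc 0 T, ‖f s‖ ≤ ε) {t : ℝ} (ht : t ∈ Icc 0 T) :
    ‖d t‖ ≤ K * (‖d 0‖ + ε * T) := by
  have hsub : Icc 0 t ⊆ Icc 0 T := Icc_subset_Icc_right ht.2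
  have hK0 : 0 ≤ K := (norm_nonneg _).trans (hK t ht)
  have hε0 : 0 ≤ ε := (norm_nonneg _).trans (hf t ht)
  set g : ℝ → E := fun s => NormedSpace.exp ((t - s) • C) (d s)
  have hg : ∀ s ∈ Icc 0 t,
      HasDerivWithinAt g (NormedSpace.exp ((t - s) • C) (f s)) (Icc 0 t) s := by
    intro s hs
    have h1 : HasDerivAt (fun s : ℝ => NormedSpace.exp ((t - s) • C))
        (-(NormedSpace.exp ((t - s) • C) * C)) s := by
      have h := (hasDerivAt_exp_smul_const C (t - s)).scomp s
        ((hasDerivAt_const s t).sub (hasDerivAt_id s))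
      simpa [Function.comp_def] using h
    have h2 := h1.hasDerivWithinAt.clm_apply ((hd s (hsub hs)).mono hsub)
    convert h2 using 1
    simp
  have h := Convex.norm_image_sub_le_of_norm_hasDerivWithin_le hg (C := K * ε) (fun s hs => by
      refine (ContinuousLinearMap.le_opNorm _ _).trans ?_
      gcongr
      exacts [hK _ ⟨by linarith [hs.2], by linarith [hs.1, ht.2]⟩, hf s (hsub hs)])
    (convex_Icc _ _) (left_mem_Icc.2 ht.1) (right_mem_Icc.2 ht.1)
  have e0 : ‖g 0‖ ≤ K * ‖d 0‖ := by
    refine (ContinuousLinearMap.le_opNorm _ _).trans ?_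
    gcongr
    simpa using hK t ht
  have et : g t = d t := by simp [g]
  rw [et, sub_zero, Real.norm_of_nonneg ht.1] at h
  have h3 : ‖d t‖ ≤ ‖d t - g 0‖ + ‖g 0‖ := by simpa using norm_add_le (d t - g 0) (g 0)
  have h4 : K * ε * t ≤ K * ε * T := by gcongr; exact ht.2
  nlinarith

lemma hasDerivWithinAt_integral_Icc {T : ℝ} {v : ℝ → E} (hv : ContinuousOn v (Icc 0 T)) {t : ℝ}
    (ht : t ∈ Icc 0 T) :
    HasDerivWithinAt (fun t => ∫ s in (0 : ℝ)..t, v s) (v t) (Icc 0 T) t := by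
  have : Fact (t ∈ Icc 0 T) := ⟨ht⟩
  refine intervalIntegral.integral_hasDerivWithinAt_right ?_ ?_ (hv t ht)
  · exact (hv.mono (by rw [uIcc_of_le ht.1]; exact Icc_subset_Icc_right ht.2)).intervalIntegrable
  · exact ⟨Icc 0 T, self_mem_nhdsWithin, hv.aestronglyMeasurable measurableSet_Icc⟩

/-- A bounded sequence of operators that tends to `0` strongly does so uniformly on compact
sets. -/
lemma eventually_forall_norm_apply_le_of_isCompact {A : ℕ → E →L[ℝ] E} {C : ℝ}
    (hC : ∀ᶠ n in atTop, ‖A n‖ ≤ C) (hA : ∀ x, Tendsto (fun n => A n x) atTop (𝓝 0))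
    {K : Set E} (hK : IsCompact K) {ε : ℝ} (hε : 0 < ε) :
    ∀ᶠ n in atTop, ∀ x ∈ K, ‖A n x‖ ≤ ε := by
  have hC1 : 0 < |C| + 1 := by positivity
  obtain ⟨s, -, hs, hKs⟩ := hK.finite_cover_balls (e := ε / 2 / (|C| + 1)) (by positivity)
  have h1 : ∀ᶠ n in atTop, ∀ y ∈ s, ‖A n y‖ < ε / 2 :=
    (hs.eventually_all).2 fun y _ => by
      have := (hA y).norm
      rw [norm_zero] at this
      exact this.eventually_lt_const (by positivity)
  filter_upwards [hC, h1] with n hn h1 x hx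
  obtain ⟨y, hy, hxy⟩ := mem_iUnion₂.1 (hKs hx)
  rw [Metric.mem_ball, dist_eq_norm] at hxy
  have h2 : ‖A n (x - y)‖ ≤ ε / 2 := by
    refine ((A n).le_of_opNorm_le (hn.trans ((le_abs_self C).trans (by linarith))) (x - y)).trans
      (b := (|C| + 1) * ‖x - y‖) ?_
    rw [← le_div_iff₀' hC1]
    exact hxy.le
  calc ‖A n x‖ = ‖A n (x - y) + A n y‖ := by rw [← map_add, sub_add_cancel]
    _ ≤ ε / 2 + ε / 2 := norm_add_le_of_le h2 (h1 y hy).le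
    _ = ε := add_halves ε

end Evolution

/-! ### Yosida approximations of the adjoint -/

section Yosida

variable {H : Type*} [NormedAddCommGroup H] [InnerProductSpace ℝ H] [CompleteSpace H]
  {𝓐 : H →ₗ.[ℝ] H}

lemma IsResolventAt.exists_apply_eq {l : ℝ} {R : H →L[ℝ] H} (h : IsResolventAt 𝓐 l R) (x : H) :
    ∃ hx : R x ∈ 𝓐.domain, 𝓐 ⟨R x, hx⟩ = l • R x - x := by
  obtain ⟨hx, e⟩ := h.1 x
  exact ⟨hx, eq_sub_iff_add_eq'.2 (sub_eq_iff_eq_add.1 e).symm⟩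

/-- The resolvent identity, in the form `(l R_l - 1) R_r = R_l (r R_r - 1)`; both sides are
`R_l 𝓐 R_r`. -/
lemma IsResolventAt.mul_eq_mul {l r : ℝ} {R R' : H →L[ℝ] H} (h : IsResolventAt 𝓐 l R)
    (h' : IsResolventAt 𝓐 r R') : (l • R - 1) * R' = R * (r • R' - 1) := by
  ext x
  obtain ⟨hx, e⟩ := h'.exists_apply_eq x
  have := h.2 ⟨R' x, hx⟩
  rw [e, map_sub, map_smul] at this
  simpa [sub_eq_iff_eq_add, add_comm] using eq_add_of_sub_eq this

lemma IsResolventAt.commute {l r : ℝ} {R R' : H →L[ℝ] H} (h : IsResolventAt 𝓐 l R)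
    (h' : IsResolventAt 𝓐 r R') : Commute R R' := by
  by_cases hlr : l = r
  · subst hlr
    rw [h.unique h']
  · have h1 := h.mul_eq_mul h'
    have h2 := h'.mul_eq_mul h
    simp only [sub_mul, mul_sub, smul_mul_assoc, mul_smul_comm, one_mul, mul_one] at h1 h2
    have h3 : (l - r) • (R * R') = (l - r) • (R' * R) := by
      linear_combination (norm := module) h1 + h2
    exact smul_right_injective _ (sub_ne_zero.2 hlr) h3

lemma IsResolventAt.injective {l : ℝ} {R : H →L[ℝ] H} (h : IsResolventAt 𝓐 l R) {x : H}
    (hx : R x = 0) : x = 0 := by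
  obtain ⟨hx', e⟩ := h.1 x
  have : (⟨R x, hx'⟩ : 𝓐.domain) = 0 := Subtype.ext hx
  rw [this, hx] at e
  simpa using e.symm

/-- The adjoint of the resolvent is a left inverse of `l - 𝓐*`. -/
lemma IsResolventAt.adjoint_apply_adjoint {l : ℝ} {R : H →L[ℝ] H} (h : IsResolventAt 𝓐 l R)
    (hd : Dense (𝓐.domain : Set H)) (y : 𝓐.adjoint.domain) :
    R.adjoint (𝓐.adjoint y) = l • R.adjoint y - y := by
  refine ext_inner_right ℝ fun x => ?_
  obtain ⟨hx, e⟩ := h.1 x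
  rw [ContinuousLinearMap.adjoint_inner_left]
  have h1 := LinearPMap.adjoint_isFormalAdjoint hd y ⟨R x, hx⟩
  simp only at h1
  rw [h1, inner_sub_left, real_inner_smul_left, ContinuousLinearMap.adjoint_inner_left]
  nth_rw 3 [← e]
  rw [inner_sub_right, real_inner_smul_right]
  ring

lemma adjoint_yosida_apply {n : ℕ} (h : IsResolventAt 𝓐 n (resolventAt 𝓐 n))
    (y : (yosida 𝓐 n).adjoint.domain) : (yosida 𝓐 n).adjoint y =
      ((n : ℝ) ^ 2 • (resolventAt 𝓐 n).adjoint - (n : ℝ) • (1 : H →L[ℝ] H)) (y : H) := by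
  have hdom : Dense ((yosida 𝓐 n).domain : Set H) := by
    have : ((yosida 𝓐 n).domain : Set H) = univ := by
      ext x
      obtain ⟨hx, -⟩ := h.1 x
      exact ⟨fun _ => mem_univ x, fun _ => hx⟩
    rw [this]
    exact dense_univ
  refine LinearPMap.adjoint_apply_eq hdom y fun x => ?_
  obtain ⟨hx, e'⟩ := h.exists_apply_eq (x : H)
  rw [yosida_apply, e']
  simp only [sub_apply, smul_apply, one_apply_eq_self, inner_sub_left, inner_sub_right,
    real_inner_smul_left, real_inner_smul_right, ContinuousLinearMap.adjoint_inner_left]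
  ring

/-- The Yosida approximation `n² R_n* - n` of the adjoint of `𝓐`, where `R_n = (n - 𝓐)⁻¹`. -/
noncomputable def yosidaAdjoint (𝓐 : H →ₗ.[ℝ] H) (n : ℕ) : H →L[ℝ] H :=
  (n : ℝ) ^ 2 • (resolventAt 𝓐 n).adjoint - (n : ℝ) • (1 : H →L[ℝ] H)

lemma norm_exp_yosidaAdjoint_le {M ω T : ℝ} (hM : 0 ≤ M) (hω : 0 ≤ ω) {n : ℕ} (hn : 2 * ω < n)
    (hb : ∀ k : ℕ, ‖resolventAt 𝓐 n ^ k‖ ≤ M / ((n : ℝ) - ω) ^ k) {s : ℝ} (hs : s ∈ Icc 0 T) :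
    ‖NormedSpace.exp (s • yosidaAdjoint 𝓐 n)‖ ≤ M * Real.exp (2 * ω * T) := by
  have hnω : 0 < (n : ℝ) - ω := by linarith
  have hb' : ∀ k : ℕ, ‖(resolventAt 𝓐 n).adjoint ^ k‖ ≤ M * (((n : ℝ) - ω)⁻¹) ^ k := fun k => by
    rw [← ContinuousLinearMap.star_eq_adjoint, ← star_pow, ContinuousLinearMap.star_eq_adjoint,
      LinearIsometryEquiv.norm_map, inv_pow, ← div_eq_mul_inv]
    exact hb k
  refine (norm_exp_smul_sub_le hb' (by positivity) hs.1).trans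
    (mul_le_mul_of_nonneg_left (Real.exp_le_exp.2 ?_) hM)
  -- `n² / (n - ω) - n = n ω / (n - ω)`, which is at most `2 ω` for `n ≥ 2 ω`
  have h1 : (n : ℝ) ^ 2 * ((n : ℝ) - ω)⁻¹ - n ≤ 2 * ω := by
    rw [sub_le_iff_le_add, ← div_eq_mul_inv, div_le_iff₀ hnω]
    nlinarith
  calc s * ((n : ℝ) ^ 2 * ((n : ℝ) - ω)⁻¹ - n) ≤ s * (2 * ω) := by gcongr; exact hs.1
    _ ≤ T * (2 * ω) := by gcongr; exact hs.2
    _ = 2 * ω * T := by ring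

/-- `n R_n* → 1` strongly. On the range of a resolvent this is the resolvent identity; that range
is dense since resolvents are injective. -/
lemma IsC0Generator.tendsto_adjoint_resolventAt (hA : IsC0Generator 𝓐) :
    (∃ C, ∀ᶠ n : ℕ in atTop, ‖(n : ℝ) • (resolventAt 𝓐 n).adjoint - 1‖ ≤ C) ∧
    ∀ x, Tendsto (fun n : ℕ => ((n : ℝ) • (resolventAt 𝓐 n).adjoint - 1) x) atTop (𝓝 0) := by
  obtain ⟨M, ω, hM, hω, hres⟩ := hA.hille_yosida
  have hlarge : ∀ᶠ n : ℕ in atTop, 2 * ω < n :=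
    tendsto_natCast_atTop_atTop.eventually_gt_atTop (2 * ω)
  have hnorm : ∀ n : ℕ, 2 * ω < n → ‖(resolventAt 𝓐 n).adjoint‖ ≤ M / ((n : ℝ) - ω) := by
    intro n hn
    rw [LinearIsometryEquiv.norm_map]
    simpa using (hres n (by linarith)).2 1
  have hbd : ∀ᶠ n : ℕ in atTop, ‖(n : ℝ) • (resolventAt 𝓐 n).adjoint - 1‖ ≤ 2 * M + 1 := by
    filter_upwards [hlarge] with n hn
    refine norm_sub_le_of_le ?_ ContinuousLinearMap.norm_id_le
    rw [norm_smul, Real.norm_of_nonneg (by positivity)]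
    calc (n : ℝ) * ‖(resolventAt 𝓐 n).adjoint‖ ≤ n * (M / ((n : ℝ) - ω)) := by
          gcongr; exact hnorm n hn
      _ ≤ 2 * M := by
          rw [← mul_div_assoc, div_le_iff₀ (by linarith)]
          nlinarith
  refine ⟨⟨_, hbd⟩, fun x => ?_⟩
  set l : ℝ := ω + 1
  have hl := (hres l (by simp [l])).1
  set P := (resolventAt 𝓐 l).adjoint
  have hdense : DenseRange P := by
    have h0 : (LinearMap.range P.toLinearMap)ᗮ = ⊥ := by
      rw [Submodule.eq_bot_iff]
      intro y hy
      refine hl.injective (ext_inner_left ℝ fun z => ?_)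
      rw [← ContinuousLinearMap.adjoint_inner_left, inner_zero_right]
      exact hy _ (LinearMap.mem_range_self P.toLinearMap z)
    have := Submodule.dense_iff_topologicalClosure_eq_top.2
      ((Submodule.topologicalClosure_eq_top_iff (K := LinearMap.range P.toLinearMap)).2 h0)
    rwa [LinearMap.coe_range] at this
  have hrange : ∀ z, Tendsto (fun n : ℕ => ((n : ℝ) • (resolventAt 𝓐 n).adjoint - 1) (P z)) atTop
      (𝓝 0) := by
    intro z
    have hlim : Tendsto (fun n : ℕ => M / ((n : ℝ) - ω) * ‖(l • P - 1) z‖) atTop (𝓝 0) := by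
      have : Tendsto (fun n : ℕ => (n : ℝ) - ω) atTop atTop :=
        tendsto_atTop_add_const_right _ _ tendsto_natCast_atTop_atTop
      simpa using (this.const_div_atTop M).mul_const ‖(l • P - 1) z‖
    refine squeeze_zero_norm' ?_ hlim
    filter_upwards [hlarge] with n hn
    have e := congrArg ContinuousLinearMap.adjoint (hl.mul_eq_mul (hres n (by linarith)).1)
    simp only [← ContinuousLinearMap.star_eq_adjoint, star_mul, star_sub, star_smul, star_one,
      star_trivial] at e
    have e' := DFunLike.congr_fun e z
    simp only [mul_apply_eq_comp, ContinuousLinearMap.star_eq_adjoint] at e'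
    rw [← e']
    exact ContinuousLinearMap.le_of_opNorm_le _ (hnorm n hn) _
  rw [Metric.tendsto_nhds]
  intro ε hε
  have hB : 0 < 2 * M + 1 := by positivity
  obtain ⟨z, hz⟩ := hdense.exists_dist_lt x (ε := ε / 2 / (2 * M + 1)) (by positivity)
  rw [dist_eq_norm, lt_div_iff₀' hB] at hz
  filter_upwards [hbd, Metric.tendsto_nhds.1 (hrange z) (ε / 2) (by positivity)] with n hn hn'
  rw [dist_zero_right] at hn' ⊢
  have h1 := ((n : ℝ) • (resolventAt 𝓐 n).adjoint - 1).le_of_opNorm_le hn (x - P z)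
  have h2 := norm_add_le (((n : ℝ) • (resolventAt 𝓐 n).adjoint - 1) (x - P z))
    (((n : ℝ) • (resolventAt 𝓐 n).adjoint - 1) (P z))
  rw [← map_add, sub_add_cancel] at h2
  linarith

/-- Mild solutions of `v' = 𝓐* v` are the uniform limits of the solutions for the Yosida
approximations. -/
theorem IsC0Generator.eventually_norm_sub_le (hA : IsC0Generator 𝓐) {T : ℝ} (hT : 0 ≤ T)
    {v₀ : H} {v : ℝ → H} {vn : ℕ → ℝ → H} (hvc : ContinuousOn v (Icc 0 T))
    (hv : ∀ t ∈ Icc 0 T, ∃ ht : (∫ s in (0 : ℝ)..t, v s) ∈ 𝓐.adjoint.domain,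
      v t = v₀ + 𝓐.adjoint ⟨∫ s in (0 : ℝ)..t, v s, ht⟩)
    (hvn : ∀ᶠ n in atTop, ContinuousOn (vn n) (Icc 0 T) ∧
      ∀ t ∈ Icc 0 T, vn n t = v₀ + yosidaAdjoint 𝓐 n (∫ s in (0 : ℝ)..t, vn n s))
    {ε : ℝ} (hε : 0 < ε) :
    ∀ᶠ n in atTop, ∀ t ∈ Icc 0 T, ‖vn n t - v t‖ ≤ ε := by
  obtain ⟨M, ω, hM, hω, hres⟩ := hA.hille_yosida
  obtain ⟨⟨C, hC⟩, hlim⟩ := hA.tendsto_adjoint_resolventAt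
  have hlarge : ∀ᶠ n : ℕ in atTop, 2 * ω < n :=
    tendsto_natCast_atTop_atTop.eventually_gt_atTop (2 * ω)
  set K := M * Real.exp (2 * ω * T)
  have hK : 0 < K := by positivity
  have hv0 : v 0 = v₀ := by
    obtain ⟨h0, e⟩ := hv 0 (left_mem_Icc.2 hT)
    have : (⟨∫ s in (0 : ℝ)..0, v s, h0⟩ : 𝓐.adjoint.domain) = 0 := Subtype.ext (by simp)
    rw [e, this]
    simp
  have hcomp : IsCompact (v '' Icc 0 T) := isCompact_Icc.image_of_continuousOn hvc
  -- the regularisation `k R_k*`, with `k` so large that it hardly moves `v`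
  obtain ⟨k, hk, hkv, hkv0⟩ : ∃ k : ℕ, 2 * ω < k ∧
      (∀ x ∈ v '' Icc 0 T, ‖((k : ℝ) • (resolventAt 𝓐 k).adjoint - 1) x‖ ≤ ε / 3) ∧
      ∀ x ∈ v '' Icc 0 T, ‖((k : ℝ) • (resolventAt 𝓐 k).adjoint - 1) x‖ ≤ ε / 3 / K :=
    (hlarge.and ((eventually_forall_norm_apply_le_of_isCompact hC hlim hcomp
      (by positivity)).and (eventually_forall_norm_apply_le_of_isCompact hC hlim hcomp
      (by positivity)))).exists
  have hkpos : (0 : ℝ) < k := by linarith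
  have hrk := (hres k (by linarith)).1
  set P := (resolventAt 𝓐 k).adjoint
  set Q := (k : ℝ) • P - 1
  have hPv : ∀ t ∈ Icc 0 T, P (v t) = P v₀ + Q (∫ s in (0 : ℝ)..t, v s) := by
    intro t ht
    obtain ⟨ht', e⟩ := hv t ht
    rw [e, map_add, hrk.adjoint_apply_adjoint hA.dense_domain]
    simp [Q, P]
  -- `‖P vₙ - P v‖` has to be below `ε / (3 k)`
  set δ := ε / 3 / k / K / (T + 1)
  have hδ : 0 < δ := by positivity
  have hconv := eventually_forall_norm_apply_le_of_isCompact hC hlim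
    (hcomp.image Q.continuous) hδ
  filter_upwards [hvn, hlarge, hconv] with n ⟨hnc, hn⟩ hnω hnδ t ht
  have hrn := (hres n (by linarith)).1
  set A := yosidaAdjoint 𝓐 n
  have hexp : ∀ s ∈ Icc 0 T, ‖NormedSpace.exp (s • A)‖ ≤ K := fun s hs =>
    norm_exp_yosidaAdjoint_le (by linarith) hω hnω (hres n (by linarith)).2 hs
  have hn0 : vn n 0 = v₀ := by simpa using hn 0 (left_mem_Icc.2 hT)
  have hcommP : ∀ x, P (A x) = A (P x) := by
    have h1 : Commute P (resolventAt 𝓐 n).adjoint := by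
      rw [← ContinuousLinearMap.star_eq_adjoint]
      exact (hrk.commute hrn).star_star
    have h2 : Commute P A := (h1.smul_right _).sub_right ((Commute.one_right P).smul_right _)
    exact fun x => DFunLike.congr_fun h2.eq x
  have hAP : ∀ x, A (P x) = Q x + ((n : ℝ) • (resolventAt 𝓐 n).adjoint - 1) (Q x) := by
    have e := congrArg ContinuousLinearMap.adjoint (hrk.mul_eq_mul hrn)
    simp only [← ContinuousLinearMap.star_eq_adjoint, star_mul, star_sub, star_smul, star_one,
      star_trivial] at e
    intro x
    have e' := DFunLike.congr_fun e x
    simp only [mul_apply_eq_comp, ContinuousLinearMap.star_eq_adjoint, sub_apply, smul_apply,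
      one_apply_eq_self] at e'
    have e'' := congrArg (fun y => (n : ℝ) • y) e'
    simp only [A, Q, P, yosidaAdjoint, sub_apply, smul_apply, one_apply_eq_self,
      smul_sub, map_sub, map_smul] at e'' ⊢
    linear_combination (norm := module) (-1 : ℝ) • e''
  have hderiv : ∀ s ∈ Icc 0 T, HasDerivWithinAt (vn n) (A (vn n s)) (Icc 0 T) s := by
    intro s hs
    have h1 := (A.hasFDerivAt.comp_hasDerivWithinAt s (hasDerivWithinAt_integral_Icc hnc hs)).const_add
      v₀
    exact h1.congr (fun r hr => hn r hr) (hn s hs)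
  have hderivP : ∀ s ∈ Icc 0 T, HasDerivWithinAt (fun s => P (v s)) (Q (v s)) (Icc 0 T) s := by
    intro s hs
    have h1 := (Q.hasFDerivAt.comp_hasDerivWithinAt s (hasDerivWithinAt_integral_Icc hvc hs)).const_add
      (P v₀)
    exact h1.congr (fun r hr => hPv r hr) (hPv s hs)
  -- the regularised difference solves an inhomogeneous equation with small right-hand side
  have hd1 : ‖P (vn n t) - P (v t)‖ ≤ ε / 3 / k := by
    have h := norm_le_of_hasDerivWithinAt_linear (d := fun s => P (vn n s) - P (v s))
      (f := fun s => ((n : ℝ) • (resolventAt 𝓐 n).adjoint - 1) (Q (v s))) (ε := δ) hexp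
      (fun s hs => by
        refine ((P.hasFDerivAt.comp_hasDerivWithinAt s (hderiv s hs)).sub
          (hderivP s hs)).congr_deriv ?_
        rw [map_sub, hAP (v s), hcommP]
        abel)
      (fun s hs => hnδ _ ⟨v s, ⟨s, hs, rfl⟩, rfl⟩) ht
    simp only [hn0, hv0, sub_self, norm_zero, zero_add] at h
    refine h.trans ?_
    calc K * (δ * T) ≤ K * (δ * (T + 1)) := by gcongr; linarith
      _ = ε / 3 / k := by simp only [δ]; field_simp
  have hd2 : ‖Q (vn n t)‖ ≤ ε / 3 := by
    have h := norm_le_of_hasDerivWithinAt_linear (d := fun s => Q (vn n s))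
      (f := fun _ => (0 : H)) (ε := 0) hexp
      (fun s hs => by
        refine (Q.hasFDerivAt.comp_hasDerivWithinAt s (hderiv s hs)).congr_deriv ?_
        simp [Q, hcommP])
      (fun s hs => by simp) ht
    have h0 := hkv0 (v 0) ⟨0, left_mem_Icc.2 hT, rfl⟩
    rw [hv0, ← hn0] at h0
    rw [zero_mul, add_zero] at h
    refine h.trans ?_
    rw [le_div_iff₀' hK] at h0
    exact h0
  have hd3 := hkv (v t) ⟨t, ht, rfl⟩
  have hsplit : vn n t - v t = (k : ℝ) • (P (vn n t) - P (v t)) - Q (vn n t) + Q (v t) := by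
    simp only [Q, sub_apply, smul_apply, one_apply_eq_self]
    module
  rw [hsplit]
  have hd1' : ‖(k : ℝ) • (P (vn n t) - P (v t))‖ ≤ ε / 3 := by
    rw [norm_smul, Real.norm_of_nonneg hkpos.le]
    rwa [← le_div_iff₀' hkpos]
  calc _ ≤ ε / 3 + ε / 3 + ε / 3 := norm_add_le_of_le (norm_sub_le_of_le hd1' hd2) hd3
    _ = ε := by ring

end Yosida

/-! ### Self-duality of the cone and rank-one operators -/

section Cone

variable {H : Type*} [NormedAddCommGroup H] [InnerProductSpace ℝ H] [CompleteSpace H]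

lemma posSemidef_of_mem_posCone {A : SelfAdjHS H} (hA : A ∈ posCone H) {ι : Type*} [Fintype ι]
    (e : ι → H) : (Matrix.of fun i j => ⟪A.op (e i), e j⟫).PosSemidef := by
  refine Matrix.PosSemidef.of_dotProduct_mulVec_nonneg ?_ fun x => ?_
  · ext i j
    simp only [Matrix.conjTranspose_apply, Matrix.of_apply, star_trivial]
    rw [A.inner_op, real_inner_comm]
  · refine (hA (∑ i, x i • e i)).trans_eq ?_
    simp only [map_sum, map_smul, sum_inner, inner_sum, real_inner_smul_left,
      real_inner_smul_right, dotProduct, Matrix.mulVec, star_trivial, Matrix.of_apply,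
      Finset.mul_sum]
    refine Finset.sum_congr rfl fun i _ => Finset.sum_congr rfl fun j _ => ?_
    rw [A.inner_op (e j), real_inner_comm (e j)]
    ring

/-- The double series of the squared matrix entries converges. -/
lemma SelfAdjHS.summable_entry_sq (A : SelfAdjHS H) :
    Summable fun p : OnbIndex H × OnbIndex H => ⟪A.op (onb H p.1), onb H p.2⟫ ^ 2 := by
  have h : ∀ i, HasSum (fun j => ⟪A.op (onb H i), onb H j⟫ ^ 2) (‖A.op (onb H i)‖ ^ 2) := fun i => by
    simpa only [real_inner_comm] using hasSum_sq_inner (onb H) (A.op (onb H i))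
  refine (summable_prod_of_nonneg fun p => sq_nonneg _).2 ⟨fun i => (h i).summable, ?_⟩
  simpa only [(h _).tsum_eq] using A.summable_op

/-- The Hilbert-Schmidt inner product is the sum of the products of the matrix entries. -/
lemma SelfAdjHS.hasSum_entry_mul (A C : SelfAdjHS H) :
    HasSum (fun p : OnbIndex H × OnbIndex H =>
      ⟪A.op (onb H p.1), onb H p.2⟫ * ⟪C.op (onb H p.1), onb H p.2⟫) ⟪A, C⟫ := by
  have hs : Summable fun p : OnbIndex H × OnbIndex H =>
      ⟪A.op (onb H p.1), onb H p.2⟫ * ⟪C.op (onb H p.1), onb H p.2⟫ := by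
    refine Summable.of_norm_bounded (A.summable_entry_sq.add C.summable_entry_sq) fun p => ?_
    rw [Real.norm_eq_abs, abs_le]
    constructor <;> nlinarith [sq_nonneg (⟪A.op (onb H p.1), onb H p.2⟫
      + ⟪C.op (onb H p.1), onb H p.2⟫), sq_nonneg (⟪A.op (onb H p.1), onb H p.2⟫
      - ⟪C.op (onb H p.1), onb H p.2⟫), sq_nonneg ⟪A.op (onb H p.1), onb H p.2⟫,
      sq_nonneg ⟪C.op (onb H p.1), onb H p.2⟫]
  have h1 := hs.hasSum.prod_fiberwise (g := fun i => ⟪A.op (onb H i), C.op (onb H i)⟫) fun i => by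
    have := (onb H).hasSum_inner_mul_inner (A.op (onb H i)) (C.op (onb H i))
    simpa only [real_inner_comm (onb H _) (C.op (onb H i))] using this
  rw [← h1.unique (SelfAdjHS.hasSum_inner_of_basis (onb H) A C)]
  exact hs.hasSum

/-- The cone of positive operators is contained in its dual cone: over a finite set of indices the
entries of two positive operators form positive semidefinite matrices, and the sum of the products
of their entries is nonnegative by Schur's product theorem. -/
lemma inner_nonneg_of_mem_posCone {A C : SelfAdjHS H} (hA : A ∈ posCone H) (hC : C ∈ posCone H) :
    0 ≤ ⟪A, C⟫ := by
  have hlim : Tendsto (fun F : Finset (OnbIndex H) => F ×ˢ F) atTop atTop :=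
    tendsto_atTop_finset_of_monotone (fun F G h => Finset.product_subset_product h h)
      fun p => by
        classical
        exact ⟨{p.1, p.2}, by simp⟩
  refine ge_of_tendsto' ((A.hasSum_entry_mul C).comp hlim) fun F => ?_
  have h := ((posSemidef_of_mem_posCone hA (fun i : F => onb H i)).hadamard
    (posSemidef_of_mem_posCone hC (fun i : F => onb H i))).dotProduct_mulVec_nonneg (fun _ => 1)
  simp only [dotProduct, Matrix.mulVec, Matrix.hadamard_apply, Matrix.of_apply, Pi.star_apply,
    star_one, one_mul, mul_one] at h
  simp only [Function.comp_apply]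
  rw [Finset.sum_product, ← Finset.sum_coe_sort F]
  simpa only [← Finset.sum_coe_sort F] using h

lemma inner_tensorSq (a c : H) : ⟪tensorSq a, tensorSq c⟫ = ⟪a, c⟫ ^ 2 := by
  refine (SelfAdjHS.hasSum_inner_of_basis (onb H) _ _).unique ?_
  have h := ((onb H).hasSum_inner_mul_inner a c).mul_right ⟪a, c⟫
  rw [← sq] at h
  refine h.congr_fun fun i => ?_
  rw [tensorSq_op, tensorSq_op, real_inner_smul_left, real_inner_smul_right,
    real_inner_comm (onb H i) c]
  ring

lemma norm_tensorSq_sub_le (a c : H) :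
    ‖tensorSq a - tensorSq c‖ ≤ (‖a‖ + ‖c‖) * ‖a - c‖ := by
  have hn : ∀ b : H, ‖tensorSq b‖ ^ 2 = ‖b‖ ^ 4 := fun b => by
    rw [← real_inner_self_eq_norm_sq, inner_tensorSq, real_inner_self_eq_norm_sq]
    ring
  refine le_of_sq_le_sq ?_ (by positivity)
  rw [mul_pow, norm_sub_sq_real, norm_sub_sq_real, hn, hn, inner_tensorSq]
  have h1 := real_inner_le_norm a c
  -- the difference of the two sides is `2 w (‖a‖² + ‖c‖² + w)`, `w = ‖a‖ ‖c‖ - ⟪a, c⟫`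
  have h2 : 0 ≤ (‖a‖ * ‖c‖ - ⟪a, c⟫) * (‖a‖ ^ 2 + ‖c‖ ^ 2
      + (‖a‖ * ‖c‖ - ⟪a, c⟫)) := by
    have h3 : 0 ≤ ‖a‖ * ‖c‖ - ⟪a, c⟫ := sub_nonneg.2 h1
    positivity
  linarith

end Cone

/-! ### Integrals against signed and vector measures -/

section SignedIntegral

variable {α : Type*} [MeasurableSpace α] {g g' : α → ℝ} {c : ℝ}

lemma integrable_of_norm_le (hg : Measurable g) (hc : ∀ a, ‖g a‖ ≤ c) (ν : Measure α)
    [IsFiniteMeasure ν] : Integrable g ν :=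
  Integrable.of_bound hg.aestronglyMeasurable c (Eventually.of_forall hc)

/-- The integral against a signed measure may be computed from any representation of it as a
difference of finite measures. -/
lemma signedIntegral_of_eq_sub {σ : SignedMeasure α} {ν ν' : Measure α} [IsFiniteMeasure ν]
    [IsFiniteMeasure ν'] (h : σ = ν.toSignedMeasure - ν'.toSignedMeasure) (hg : Measurable g)
    (hc : ∀ a, ‖g a‖ ≤ c) : signedIntegral σ g = ∫ a, g a ∂ν - ∫ a, g a ∂ν' := by
  set p := σ.toJordanDecomposition.posPart
  set q := σ.toJordanDecomposition.negPart
  have hσ : p.toSignedMeasure - q.toSignedMeasure = σ := σ.toSignedMeasure_toJordanDecomposition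
  have e : p + ν' = ν + q := by
    rw [← Measure.toSignedMeasure_eq_toSignedMeasure_iff, Measure.toSignedMeasure_add,
      Measure.toSignedMeasure_add]
    rw [← hσ] at h
    exact sub_eq_sub_iff_add_eq_add.1 h
  have hi := fun (ν : Measure α) [IsFiniteMeasure ν] => integrable_of_norm_le hg hc ν
  have h2 := congrArg (fun ν => ∫ a, g a ∂ν) e
  simp only [integral_add_measure (hi _) (hi _)] at h2
  exact sub_eq_sub_iff_add_eq_add.2 h2

lemma signedIntegral_add (σ τ : SignedMeasure α) (hg : Measurable g) (hc : ∀ a, ‖g a‖ ≤ c) :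
    signedIntegral (σ + τ) g = signedIntegral σ g + signedIntegral τ g := by
  have hi := fun (ν : Measure α) [IsFiniteMeasure ν] => integrable_of_norm_le hg hc ν
  have e : σ + τ
      = (σ.toJordanDecomposition.posPart + τ.toJordanDecomposition.posPart).toSignedMeasure
        - (σ.toJordanDecomposition.negPart + τ.toJordanDecomposition.negPart).toSignedMeasure := by
    have h1 := σ.toSignedMeasure_toJordanDecomposition
    have h2 := τ.toSignedMeasure_toJordanDecomposition
    rw [JordanDecomposition.toSignedMeasure] at h1 h2
    rw [Measure.toSignedMeasure_add, Measure.toSignedMeasure_add, add_sub_add_comm, h1, h2]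
  rw [signedIntegral_of_eq_sub e hg hc, integral_add_measure (hi _) (hi _),
    integral_add_measure (hi _) (hi _), signedIntegral, signedIntegral]
  ring

lemma signedIntegral_sub (σ : SignedMeasure α) (hg : Integrable g σ.totalVariation)
    (hg' : Integrable g' σ.totalVariation) :
    signedIntegral σ (fun a => g a - g' a) = signedIntegral σ g - signedIntegral σ g' := by
  rw [SignedMeasure.totalVariation, integrable_add_measure] at hg hg'
  simp only [signedIntegral]
  rw [integral_sub hg.1 hg'.1, integral_sub hg.2 hg'.2]
  ring

instance (σ : SignedMeasure α) : IsFiniteMeasure σ.totalVariation := by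
  rw [SignedMeasure.totalVariation]
  infer_instance

lemma abs_signedIntegral_le (σ : SignedMeasure α) (hc : ∀ a, ‖g a‖ ≤ c) :
    |signedIntegral σ g| ≤ c * σ.totalVariation.real univ := by
  have h1 := norm_integral_le_of_norm_le_const (μ := σ.toJordanDecomposition.posPart)
    (Eventually.of_forall hc)
  have h2 := norm_integral_le_of_norm_le_const (μ := σ.toJordanDecomposition.negPart)
    (Eventually.of_forall hc)
  rw [SignedMeasure.totalVariation, measureReal_add_apply, mul_add]
  exact (abs_sub _ _).trans (add_le_add h1 h2)

/-- The total mass of the total variation, through a Hahn decomposition. -/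
lemma exists_totalVariation_univ_eq (σ : SignedMeasure α) :
    ∃ s : Set α, σ.totalVariation.real univ = σ sᶜ - σ s := by
  set j := σ.toJordanDecomposition
  obtain ⟨s, hs, -, -, h1, h2⟩ := j.exists_compl_positive_negative
  refine ⟨s, ?_⟩
  have hp := measureReal_add_measureReal_compl (μ := j.posPart) hs
  have hn := measureReal_add_measureReal_compl (μ := j.negPart) hs
  rw [σ.apply_eq_posPart_real_sub_negPart_real hs,
    σ.apply_eq_posPart_real_sub_negPart_real hs.compl, SignedMeasure.totalVariation,
    measureReal_add_apply]
  have h1' : j.posPart.real s = 0 := by simp [measureReal_def, h1]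
  have h2' : j.negPart.real sᶜ = 0 := by simp [measureReal_def, h2]
  change j.posPart.real univ + j.negPart.real univ = j.posPart.real sᶜ - j.negPart.real sᶜ
    - (j.posPart.real s - j.negPart.real s)
  linarith

end SignedIntegral

section VectorIntegral

variable {H : Type*} [NormedAddCommGroup H] [InnerProductSpace ℝ H] [CompleteSpace H]
  (μ : VectorMeasure (PuncturedCone H) (SelfAdjHS H))

/-- The range of a vector measure is weakly bounded, hence bounded. -/
lemma exists_norm_vectorMeasure_le : ∃ C, 0 ≤ C ∧ ∀ s, ‖μ s‖ ≤ C := by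
  obtain ⟨C, hC⟩ := banach_steinhaus (g := fun s => innerSL ℝ (μ s)) (fun x =>
    ⟨(pairing μ x).totalVariation.real univ, fun s => by
      rw [innerSL_apply_apply, ← pairing_apply]
      exact ((pairing μ x).norm_le_totalVariation s).trans (measureReal_mono (subset_univ s))⟩)
  refine ⟨C, (norm_nonneg _).trans (hC univ), fun s => ?_⟩
  simpa using hC s

lemma exists_totalVariation_pairing_le :
    ∃ C, 0 ≤ C ∧ ∀ x, (pairing μ x).totalVariation.real univ ≤ C * ‖x‖ := by
  obtain ⟨C, hC0, hC⟩ := exists_norm_vectorMeasure_le μ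
  refine ⟨2 * C, by positivity, fun x => ?_⟩
  obtain ⟨s, hs⟩ := exists_totalVariation_univ_eq (pairing μ x)
  rw [hs, pairing_apply, pairing_apply]
  have h1 : ∀ s, |⟪μ s, x⟫| ≤ C * ‖x‖ := fun s =>
    (abs_real_inner_le_norm _ _).trans (by gcongr; exact hC s)
  linarith [(abs_le.1 (h1 sᶜ)).2, (abs_le.1 (h1 s)).1]

lemma pairing_add (x y : SelfAdjHS H) : pairing μ (x + y) = pairing μ x + pairing μ y := by
  ext s
  simp [pairing_apply, inner_add_right]

/-- Bounded measurable functions have a weak integral against a vector measure. -/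
lemma exists_isVectorIntegral {g : PuncturedCone H → ℝ} {c : ℝ} (hg : Measurable g)
    (hc : ∀ a, ‖g a‖ ≤ c) : ∃ w, IsVectorIntegral μ g w := by
  obtain ⟨C, hC0, hC⟩ := exists_totalVariation_pairing_le μ
  have hc0 : 0 ≤ |c| := abs_nonneg c
  let L : SelfAdjHS H →+ ℝ := AddMonoidHom.mk' (fun x => signedIntegral (pairing μ x) g)
    fun x y => by rw [pairing_add, signedIntegral_add _ _ hg hc]
  have hL : ∀ x, ‖L x‖ ≤ |c| * C * ‖x‖ := fun x => by
    refine (abs_signedIntegral_le _ (fun a => (hc a).trans (le_abs_self c))).trans ?_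
    rw [mul_assoc]
    gcongr
    exact hC x
  let L' := L.toRealLinearMap (AddMonoidHomClass.continuous_of_bound L _ hL)
  refine ⟨(InnerProductSpace.toDual ℝ _).symm L', fun x => ⟨integrable_of_norm_le hg hc _, ?_⟩⟩
  rw [InnerProductSpace.toDual_symm_apply]
  rfl

lemma isVectorIntegral_vectorIntegral {g : PuncturedCone H → ℝ} {c : ℝ} (hg : Measurable g)
    (hc : ∀ a, ‖g a‖ ≤ c) : IsVectorIntegral μ g (vectorIntegral μ g) := by
  have h := exists_isVectorIntegral μ hg hc
  rw [vectorIntegral, dif_pos h]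
  exact h.choose_spec

/-- The vector integral is Lipschitz for the supremum norm. -/
lemma exists_norm_vectorIntegral_sub_le :
    ∃ C, 0 ≤ C ∧ ∀ (g g' : PuncturedCone H → ℝ) (c c' ε : ℝ), Measurable g → Measurable g' →
      (∀ a, ‖g a‖ ≤ c) → (∀ a, ‖g' a‖ ≤ c') → 0 ≤ ε → (∀ a, ‖g a - g' a‖ ≤ ε) →
      ‖vectorIntegral μ g - vectorIntegral μ g'‖ ≤ C * ε := by
  obtain ⟨C, hC0, hC⟩ := exists_totalVariation_pairing_le μ
  refine ⟨C, hC0, fun g g' c c' ε hg hg' hc hc' hε hd => ?_⟩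
  set w := vectorIntegral μ g - vectorIntegral μ g'
  obtain ⟨hi, e⟩ := isVectorIntegral_vectorIntegral μ hg hc w
  obtain ⟨hi', e'⟩ := isVectorIntegral_vectorIntegral μ hg' hc' w
  have h : ‖w‖ * ‖w‖ ≤ C * ε * ‖w‖ := by
    rw [← real_inner_self_eq_norm_mul_norm]
    calc ⟪w, w⟫ = signedIntegral (pairing μ w) fun a => g a - g' a := by
          rw [signedIntegral_sub _ hi hi', ← e, ← e', ← inner_sub_left]
      _ ≤ ε * (pairing μ w).totalVariation.real univ :=
          (le_abs_self _).trans (abs_signedIntegral_le _ hd)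
      _ ≤ ε * (C * ‖w‖) := by gcongr; exact hC w
      _ = C * ε * ‖w‖ := by ring
  rcases (norm_nonneg w).eq_or_lt with h0 | h0
  · rw [← h0]; positivity
  · exact le_of_mul_le_mul_right h h0

end VectorIntegral

/-! ### Local Lipschitz estimates for the coefficients of the Riccati equations -/

lemma exp_neg_sub_exp_neg_bounds {x y : ℝ} (hy : 0 ≤ y) (hyx : y ≤ x) :
    (1 - x) * (x - y) ≤ Real.exp (-y) - Real.exp (-x) ∧
      Real.exp (-y) - Real.exp (-x) ≤ x - y := by
  have h1 := Real.add_one_le_exp (x - y)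
  have h2 := Real.add_one_le_exp (y - x)
  have e1 : Real.exp (-y) = Real.exp (-x) * Real.exp (x - y) := by rw [← Real.exp_add]; ring_nf
  have e2 : Real.exp (-x) = Real.exp (-y) * Real.exp (y - x) := by rw [← Real.exp_add]; ring_nf
  have h3 := Real.add_one_le_exp (-x)
  have h4 : Real.exp (-y) ≤ 1 := Real.exp_le_one_iff.2 (by linarith)
  constructor
  · rw [e1]
    nlinarith [Real.exp_pos (-x)]
  · rw [e2]
    nlinarith [Real.exp_pos (-y)]

lemma abs_exp_neg_sub_exp_neg_le {x y : ℝ} (hx : 0 ≤ x) (hy : 0 ≤ y) :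
    |Real.exp (-x) - Real.exp (-y)| ≤ |x - y| := by
  rcases le_total y x with h | h
  · obtain ⟨-, h2⟩ := exp_neg_sub_exp_neg_bounds hy h
    rw [abs_sub_comm, abs_of_nonneg (sub_nonneg.2 (Real.exp_le_exp.2 (neg_le_neg h))),
      abs_of_nonneg (sub_nonneg.2 h)]
    exact h2
  · obtain ⟨-, h2⟩ := exp_neg_sub_exp_neg_bounds hx h
    rw [abs_of_nonneg (sub_nonneg.2 (Real.exp_le_exp.2 (neg_le_neg h))), abs_sub_comm,
      abs_of_nonneg (sub_nonneg.2 h)]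
    exact h2

lemma abs_exp_neg_add_sub_le {x y c : ℝ} (hx : 0 ≤ x) (hy : 0 ≤ y) (hxc : x ≤ c) (hyc : y ≤ c) :
    |(Real.exp (-x) + x) - (Real.exp (-y) + y)| ≤ c * |x - y| := by
  rcases le_total y x with h | h
  · obtain ⟨h1, h2⟩ := exp_neg_sub_exp_neg_bounds hy h
    rw [abs_of_nonneg (sub_nonneg.2 h), abs_of_nonneg (by linarith)]
    nlinarith
  · obtain ⟨h1, h2⟩ := exp_neg_sub_exp_neg_bounds hx h
    rw [abs_of_nonpos (sub_nonpos.2 h), abs_of_nonpos (by linarith)]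
    nlinarith

section Coefficients

variable {H : Type*} [NormedAddCommGroup H] [InnerProductSpace ℝ H] [CompleteSpace H]

lemma zero_mem_posCone : (0 : SelfAdjHS H) ∈ posCone H := fun h => by simp

lemma jumpKernel_zero (ξ : SelfAdjHS H) : jumpKernel ξ 0 = 0 := by simp [jumpKernel]

/-- The jump kernel is Lipschitz in `u`, with a constant of order `‖ξ‖²` both for small and for
large jumps. This uses `0 ≤ ⟪ξ, u⟫`. -/
lemma abs_jumpKernel_sub_le {ξ u u' : SelfAdjHS H} {r : ℝ} (hξ : ξ ∈ posCone H)
    (hu : u ∈ posCone H) (hu' : u' ∈ posCone H) (hr : ‖u‖ ≤ r) (hr' : ‖u'‖ ≤ r) :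
    |jumpKernel ξ u - jumpKernel ξ u'| ≤ (r + 1) * ‖u - u'‖ * ‖ξ‖ ^ 2 := by
  have hr0 : 0 ≤ r := (norm_nonneg u).trans hr
  have hx := inner_nonneg_of_mem_posCone hξ hu
  have hy := inner_nonneg_of_mem_posCone hξ hu'
  have hd : |⟪ξ, u⟫ - ⟪ξ, u'⟫| ≤ ‖ξ‖ * ‖u - u'‖ := by
    rw [← inner_sub_right]
    exact abs_real_inner_le_norm _ _
  by_cases h : ‖ξ‖ ≤ 1
  · have hc : ∀ w : SelfAdjHS H, ‖w‖ ≤ r → ⟪ξ, w⟫ ≤ ‖ξ‖ * r := fun w hw =>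
      (real_inner_le_norm _ _).trans (by gcongr)
    have h1 := abs_exp_neg_add_sub_le hx hy (hc u hr) (hc u' hr')
    simp only [jumpKernel, chi, if_pos h]
    calc _ = |(Real.exp (-⟪ξ, u⟫) + ⟪ξ, u⟫) - (Real.exp (-⟪ξ, u'⟫) + ⟪ξ, u'⟫)| := by ring_nf
      _ ≤ ‖ξ‖ * r * (‖ξ‖ * ‖u - u'‖) := h1.trans (by gcongr)
      _ = r * ‖u - u'‖ * ‖ξ‖ ^ 2 := by ring
      _ ≤ _ := by gcongr; linarith
  · have h1 := abs_exp_neg_sub_exp_neg_le hx hy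
    simp only [jumpKernel, chi, if_neg h, inner_zero_left, add_zero]
    calc _ = |Real.exp (-⟪ξ, u⟫) - Real.exp (-⟪ξ, u'⟫)| := by ring_nf
      _ ≤ ‖ξ‖ * ‖u - u'‖ := h1.trans hd
      _ ≤ ‖ξ‖ ^ 2 * ‖u - u'‖ := by
        gcongr
        nlinarith [not_le.1 h]
      _ = 1 * ‖u - u'‖ * ‖ξ‖ ^ 2 := by ring
      _ ≤ _ := by gcongr; linarith

lemma abs_jumpKernel_le {ξ u : SelfAdjHS H} (hξ : ξ ∈ posCone H) (hu : u ∈ posCone H) :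
    |jumpKernel ξ u| ≤ (‖u‖ + 1) * ‖u‖ * ‖ξ‖ ^ 2 := by
  simpa [jumpKernel_zero] using
    abs_jumpKernel_sub_le hξ hu zero_mem_posCone le_rfl (by simp)

lemma measurable_jumpKernel (u : SelfAdjHS H) :
    Measurable fun ξ : PuncturedCone H => jumpKernel ξ.1 u := by
  have h1 : Measurable fun ξ : SelfAdjHS H => ⟪ξ, u⟫ :=
    (continuous_id.inner continuous_const).measurable
  have h2 : Measurable fun ξ : SelfAdjHS H => ⟪chi ξ, u⟫ := by
    have e : (fun ξ : SelfAdjHS H => ⟪chi ξ, u⟫) = fun ξ => if ‖ξ‖ ≤ 1 then ⟪ξ, u⟫ else 0 := by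
      ext ξ
      unfold chi
      split_ifs <;> simp
    rw [e]
    exact Measurable.ite (measurableSet_le measurable_norm measurable_const) h1 measurable_const
  exact ((((Real.measurable_exp.comp h1.neg).sub_const 1).add h2).comp measurable_subtype_coe)

lemma measurable_jumpKernel_div (u : SelfAdjHS H) :
    Measurable fun ξ : PuncturedCone H => jumpKernel ξ.1 u / ‖ξ.1‖ ^ 2 :=
  (measurable_jumpKernel u).div ((measurable_norm.comp measurable_subtype_coe).pow_const 2)

variable {p : ParamSet H}

lemma ParamSet.IsAdmissible.integrable_norm_sq (hp : p.IsAdmissible) :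
    Integrable (fun ξ : PuncturedCone H => ‖ξ.1‖ ^ 2) p.m := by
  refine ⟨((measurable_norm.comp measurable_subtype_coe).pow_const 2).aestronglyMeasurable, ?_⟩
  have := hp.m_second_moment
  simpa [HasFiniteIntegral] using this

lemma ParamSet.IsAdmissible.integrable_jumpKernel (hp : p.IsAdmissible) {u : SelfAdjHS H}
    (hu : u ∈ posCone H) : Integrable (fun ξ : PuncturedCone H => jumpKernel ξ.1 u) p.m :=
  (hp.integrable_norm_sq.const_mul ((‖u‖ + 1) * ‖u‖)).mono'
    (measurable_jumpKernel u).aestronglyMeasurable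
    (Eventually.of_forall fun ξ => abs_jumpKernel_le ξ.2.1 hu)

/-- `F` is Lipschitz on bounded subsets of the cone. -/
lemma ParamSet.IsAdmissible.exists_lipschitz_riccatiF (hp : p.IsAdmissible) {r : ℝ} (hr : 0 ≤ r) :
    ∃ L, 0 ≤ L ∧ ∀ u ∈ posCone H, ∀ u' ∈ posCone H, ‖u‖ ≤ r → ‖u'‖ ≤ r →
      ‖riccatiF p u - riccatiF p u'‖ ≤ L * ‖u - u'‖ := by
  refine ⟨‖p.b‖ + (r + 1) * ∫ ξ, ‖ξ.1‖ ^ 2 ∂p.m, ?_, fun u hu u' hu' hur hur' => ?_⟩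
  · have : 0 ≤ ∫ ξ, ‖ξ.1‖ ^ 2 ∂p.m := integral_nonneg fun ξ => by positivity
    positivity
  have e : riccatiF p u - riccatiF p u'
      = ⟪p.b, u - u'⟫ - ∫ ξ, (jumpKernel ξ.1 u - jumpKernel ξ.1 u') ∂p.m := by
    rw [integral_sub (hp.integrable_jumpKernel hu) (hp.integrable_jumpKernel hu'),
      inner_sub_right, riccatiF, riccatiF]
    ring
  have h1 := norm_integral_le_of_norm_le
    (f := fun ξ : PuncturedCone H => jumpKernel ξ.1 u - jumpKernel ξ.1 u')
    (hp.integrable_norm_sq.const_mul ((r + 1) * ‖u - u'‖))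
    (Eventually.of_forall fun ξ => abs_jumpKernel_sub_le ξ.2.1 hu hu' hur hur')
  rw [integral_const_mul] at h1
  rw [e]
  refine (norm_sub_le_of_le (norm_inner_le_norm p.b (u - u')) h1).trans_eq ?_
  ring

lemma norm_fst_le (z : Cx H) : ‖z.fst‖ ≤ ‖z‖ := by
  refine le_of_sq_le_sq ?_ (norm_nonneg _)
  rw [WithLp.prod_norm_sq_eq_of_L2]
  exact le_add_of_nonneg_right (sq_nonneg _)

lemma norm_snd_le (z : Cx H) : ‖z.snd‖ ≤ ‖z‖ := by
  refine le_of_sq_le_sq ?_ (norm_nonneg _)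
  rw [WithLp.prod_norm_sq_eq_of_L2]
  exact le_add_of_nonneg_left (sq_nonneg _)

lemma norm_cxTensorSq_cxMap_sub_le (C : H →L[ℝ] H) {h h' : Cx H} {r : ℝ} (hr : ‖h‖ ≤ r)
    (hr' : ‖h'‖ ≤ r) :
    ‖cxTensorSq (cxMap C h) - cxTensorSq (cxMap C h')‖ ≤ 4 * ‖C‖ ^ 2 * r * ‖h - h'‖ := by
  have hr0 : 0 ≤ r := (norm_nonneg h).trans hr
  have key : ∀ x x' : H, ‖x‖ ≤ r → ‖x'‖ ≤ r → ‖x - x'‖ ≤ ‖h - h'‖ →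
      ‖tensorSq (C x) - tensorSq (C x')‖ ≤ 2 * ‖C‖ ^ 2 * r * ‖h - h'‖ := by
    intro x x' hx hx' hd
    refine (norm_tensorSq_sub_le _ _).trans ?_
    rw [← map_sub]
    calc (‖C x‖ + ‖C x'‖) * ‖C (x - x')‖ ≤ (‖C‖ * r + ‖C‖ * r) * (‖C‖ * ‖h - h'‖) := by
          gcongr
          exacts [C.le_of_opNorm_le_of_le le_rfl hx, C.le_of_opNorm_le_of_le le_rfl hx',
            C.le_of_opNorm_le_of_le le_rfl hd]
      _ = _ := by ring
  have e : cxTensorSq (cxMap C h) - cxTensorSq (cxMap C h')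
      = (tensorSq (C h.fst) - tensorSq (C h'.fst)) - (tensorSq (C h.snd) - tensorSq (C h'.snd)) := by
    exact sub_sub_sub_comm _ _ _ _
  rw [e]
  refine (norm_sub_le_of_le
    (key _ _ ((norm_fst_le h).trans hr) ((norm_fst_le h').trans hr') (norm_fst_le (h - h')))
    (key _ _ ((norm_snd_le h).trans hr) ((norm_snd_le h').trans hr') (norm_snd_le (h - h')))).trans_eq
    ?_
  ring

/-- `R` is Lipschitz on bounded sets. -/
lemma exists_lipschitz_riccatiR (p : ParamSet H) (D : H →L[ℝ] H) {r : ℝ} (hr : 0 ≤ r) :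
    ∃ L, 0 ≤ L ∧ ∀ u ∈ posCone H, ∀ u' ∈ posCone H, ∀ h h' : Cx H, ‖u‖ ≤ r → ‖u'‖ ≤ r →
      ‖h‖ ≤ r → ‖h'‖ ≤ r →
      ‖riccatiR p D h u - riccatiR p D h' u'‖ ≤ L * (‖u - u'‖ + ‖h - h'‖) := by
  obtain ⟨C, hC0, hC⟩ := exists_norm_vectorIntegral_sub_le p.μ
  set a := ‖ContinuousLinearMap.adjoint p.B‖
  set q := 2 * ‖posSqrt D‖ ^ 2 * r
  refine ⟨a + C * (r + 1) + q, by positivity, fun u hu u' hu' h h' hur hur' hh hh' => ?_⟩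
  have hpos : ∀ ξ : PuncturedCone H, 0 < ‖ξ.1‖ ^ 2 := fun ξ => by
    have := norm_pos_iff.2 ξ.2.2
    positivity
  have hb : ∀ w ∈ posCone H, ∀ ξ : PuncturedCone H,
      ‖jumpKernel ξ.1 w / ‖ξ.1‖ ^ 2‖ ≤ (‖w‖ + 1) * ‖w‖ := fun w hw ξ => by
    rw [norm_div, Real.norm_of_nonneg (hpos ξ).le, div_le_iff₀ (hpos ξ)]
    exact abs_jumpKernel_le ξ.2.1 hw
  have h1 := hC _ _ _ _ ((r + 1) * ‖u - u'‖) (measurable_jumpKernel_div u)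
    (measurable_jumpKernel_div u') (hb u hu) (hb u' hu') (by positivity) fun ξ => by
      rw [← sub_div, norm_div, Real.norm_of_nonneg (hpos ξ).le, div_le_iff₀ (hpos ξ)]
      exact abs_jumpKernel_sub_le ξ.2.1 hu hu' hur hur'
  have h2 := norm_cxTensorSq_cxMap_sub_le (posSqrt D) hh hh'
  have h3 : ‖ContinuousLinearMap.adjoint p.B (u - u')‖ ≤ a * ‖u - u'‖ :=
    ContinuousLinearMap.le_opNorm _ _
  have e : riccatiR p D h u - riccatiR p D h' u'
      = ContinuousLinearMap.adjoint p.B (u - u')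
        - (1 / 2 : ℝ) • (cxTensorSq (cxMap (posSqrt D) h) - cxTensorSq (cxMap (posSqrt D) h'))
        - (vectorIntegral p.μ (fun ξ => jumpKernel ξ.1 u / ‖ξ.1‖ ^ 2)
          - vectorIntegral p.μ (fun ξ => jumpKernel ξ.1 u' / ‖ξ.1‖ ^ 2)) := by
    simp only [riccatiR, map_sub]
    module
  have h2' : ‖(1 / 2 : ℝ) • (cxTensorSq (cxMap (posSqrt D) h) - cxTensorSq (cxMap (posSqrt D) h'))‖
      ≤ q * ‖h - h'‖ := by
    rw [norm_smul, Real.norm_of_nonneg (by norm_num)]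
    simp only [q]
    linarith
  rw [e]
  refine (norm_sub_le_of_le (norm_sub_le_of_le h3 h2') h1).trans ?_
  have e1 : 0 ≤ (a + C * (r + 1)) * ‖h - h'‖ := by positivity
  have e2 : 0 ≤ q * ‖u - u'‖ := by positivity
  linarith

end Coefficients

/-! ### Stability of solutions of differential equations -/

section Stability

variable {E : Type*} [NormedAddCommGroup E] [NormedSpace ℝ E] {T : ℝ} {d d' : ℝ → E}

lemma hasDerivWithinAt_Ici_of_Icc {t : ℝ} (ht : t ∈ Ioo 0 T) {y : E}
    (h : HasDerivWithinAt d y (Icc 0 T) t) : HasDerivWithinAt d y (Ici t) t :=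
  (h.hasDerivAt (Icc_mem_nhds ht.1 ht.2)).hasDerivWithinAt

/-- A Gronwall estimate that needs the differential inequality only where `‖d‖ ≤ 1`, so that a local
Lipschitz condition suffices. The derivative at `0` is not needed. -/
lemma norm_le_of_norm_deriv_le_local {L ε : ℝ} (hL : 0 ≤ L) (hε : 0 < ε)
    (hc : ContinuousOn d (Icc 0 T)) (h0 : d 0 = 0)
    (hd : ∀ t ∈ Ioc 0 T, HasDerivWithinAt d (d' t) (Icc 0 T) t)
    (hb : ∀ t ∈ Ioc 0 T, ‖d t‖ ≤ 1 → ‖d' t‖ ≤ L * (‖d t‖ + ε))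
    (hsmall : (L + 1) * ε * Real.exp ((L + 1) * T) ≤ 1) {t : ℝ} (ht : t ∈ Icc 0 T) :
    ‖d t‖ ≤ (L + 1) * ε * Real.exp ((L + 1) * T) := by
  have hη : 0 < (L + 1) * ε := by positivity
  rcases ht.1.eq_or_lt with rfl | ht0
  · rw [h0, norm_zero]; positivity
  -- a starting time `a > 0` at which `d` is still small
  obtain ⟨a, ⟨ha0, hat⟩, ha⟩ : ∃ a ∈ Ioo 0 t, ‖d a‖ ≤ (L + 1) * ε := by
    have h1 : Tendsto (fun s => ‖d s‖) (𝓝[>] 0) (𝓝 0) := by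
      have := ((hc 0 (left_mem_Icc.2 (ht.1.trans ht.2))).mono_of_mem_nhdsWithin
        (Icc_mem_nhdsGT (ht0.trans_le ht.2))).norm
      simpa [ContinuousWithinAt, h0] using this
    have h2 : ∀ᶠ s in 𝓝[>] 0, s ∈ Ioo 0 t := Ioo_mem_nhdsGT ht0
    exact (h2.and (h1.eventually_le_const hη)).exists
  have hBle : ∀ s ≤ T, (L + 1) * ε * Real.exp ((L + 1) * s)
      ≤ (L + 1) * ε * Real.exp ((L + 1) * T) := fun s hs => by gcongr
  have hle : ∀ s, 0 ≤ s → (L + 1) * ε ≤ (L + 1) * ε * Real.exp ((L + 1) * s) := fun s hs =>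
    le_mul_of_one_le_right hη.le (Real.one_le_exp (by positivity))
  refine (image_norm_le_of_norm_deriv_right_lt_deriv_boundary (f := d) (f' := d') (a := a) (b := T)
    (B := fun s => (L + 1) * ε * Real.exp ((L + 1) * s))
    (B' := fun s => (L + 1) * ε * (Real.exp ((L + 1) * s) * (L + 1)))
    (hc.mono (Icc_subset_Icc_left ha0.le)) (fun s hs => ?_) (ha.trans (hle a ha0.le)) (fun s => ?_)
    (fun s hs hs' => ?_) ⟨hat.le, ht.2⟩).trans (hBle t ht.2)
  · have hs0 : 0 < s := ha0.trans_le hs.1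
    exact hasDerivWithinAt_Ici_of_Icc ⟨hs0, hs.2⟩ (hd s ⟨hs0, hs.2.le⟩)
  · simpa using (((hasDerivAt_id s).const_mul (L + 1)).exp).const_mul ((L + 1) * ε)
  · have hs0 : 0 < s := ha0.trans_le hs.1
    have h1 := hb s ⟨hs0, hs.2.le⟩ (hs'.le.trans ((hBle s hs.2.le).trans hsmall))
    rw [hs'] at h1
    have h2 := hle s hs0.le
    nlinarith

lemma norm_le_of_norm_deriv_le_const {C : ℝ} (hC : 0 ≤ C)
    (hc : ContinuousOn d (Icc 0 T)) (h0 : d 0 = 0)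
    (hd : ∀ t ∈ Ioc 0 T, HasDerivWithinAt d (d' t) (Icc 0 T) t)
    (hb : ∀ t ∈ Ioc 0 T, ‖d' t‖ ≤ C) {t : ℝ} (ht : t ∈ Icc 0 T) : ‖d t‖ ≤ C * T := by
  have hT : 0 ≤ T := ht.1.trans ht.2
  rcases ht.1.eq_or_lt with rfl | ht0
  · rw [h0, norm_zero]; positivity
  have h1 : ∀ s ∈ Ioc 0 t, ‖d t - d s‖ ≤ C * T := fun s hs => by
    have h := Convex.norm_image_sub_le_of_norm_hasDerivWithin_le (s := Ioc 0 T) (x := s) (y := t)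
      (fun r hr => (hd r hr).mono Ioc_subset_Icc_self) hb (convex_Ioc _ _)
      ⟨hs.1, hs.2.trans ht.2⟩ ⟨ht0, ht.2⟩
    refine h.trans ?_
    gcongr
    rw [Real.norm_of_nonneg (by linarith [hs.2])]
    linarith [hs.1, ht.2]
  have h2 : Tendsto (fun s => ‖d t - d s‖) (𝓝[>] 0) (𝓝 ‖d t - 0‖) := by
    have : ContinuousWithinAt d (Ioi 0) 0 := (hc 0 (left_mem_Icc.2 hT)).mono_of_mem_nhdsWithin
      (Icc_mem_nhdsGT (ht0.trans_le ht.2))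
    rw [ContinuousWithinAt, h0] at this
    exact (tendsto_const_nhds.sub this).norm
  rw [sub_zero] at h2
  refine le_of_tendsto h2 ?_
  filter_upwards [Ioc_mem_nhdsGT ht0] with s hs using h1 s hs

/-- Uniform convergence in terms of suprema with values in `[0, ∞]`. -/
lemma tendsto_iSup_enorm_zero {f : ℕ → ℝ → E} {s : Set ℝ}
    (h : ∀ ε : ℝ, 0 < ε → ∀ᶠ n in atTop, ∀ t ∈ s, ‖f n t‖ ≤ ε) :
    Tendsto (fun n => ⨆ t ∈ s, ‖f n t‖ₑ) atTop (𝓝 0) := by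
  rw [ENNReal.tendsto_nhds_zero]
  intro ε hε
  have hm : min ε 1 ≠ ⊤ := ((min_le_right ε 1).trans_lt ENNReal.one_lt_top).ne
  have hpos : 0 < (min ε 1).toReal := ENNReal.toReal_pos (lt_min hε one_pos).ne' hm
  filter_upwards [h _ hpos] with n hn
  refine iSup₂_le fun t ht => ?_
  rw [← ofReal_norm]
  exact (ENNReal.ofReal_le_ofReal (hn t ht)).trans
    ((ENNReal.ofReal_toReal hm).trans_le (min_le_left _ _))

end Stability

/-! ### Mild solutions -/

section MildSolution

variable {H : Type*} [NormedAddCommGroup H] [InnerProductSpace ℝ H] [CompleteSpace H]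
  {p : ParamSet H} {𝓐 : H →ₗ.[ℝ] H} {D : H →L[ℝ] H} {T : ℝ} {u₁ : Cx H} {u₂ : SelfAdjHS H}
  {Φ : ℝ → ℝ} {ψ₁ : ℝ → Cx H} {ψ₂ : ℝ → SelfAdjHS H}

lemma IsMildSolution.continuousOn_snd (h : IsMildSolution p 𝓐 D T u₁ u₂ Φ ψ₁ ψ₂) :
    ContinuousOn (fun t => (ψ₁ t).snd) (Icc 0 T) :=
  (WithLp.prod_continuous_ofLp 2 H H).snd.comp_continuousOn h.continuous_ψ₁

/-- With `ψ₁ = i v`, the second Riccati equation reads `v(t) = v(0) + 𝓐* ∫₀ᵗ v(s) ds`. -/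
lemma IsMildSolution.snd_eq (h : IsMildSolution p 𝓐 D T u₁ u₂ Φ ψ₁ ψ₂) {t : ℝ}
    (ht : t ∈ Icc 0 T) : ∃ hV : (∫ s in (0 : ℝ)..t, (ψ₁ s).snd) ∈ 𝓐.adjoint.domain,
      (ψ₁ t).snd = u₁.snd + 𝓐.adjoint ⟨∫ s in (0 : ℝ)..t, (ψ₁ s).snd, hV⟩ := by
  rcases ht.1.eq_or_lt with rfl | ht0
  · have h0 : (∫ s in (0 : ℝ)..0, (ψ₁ s).snd) = 0 := intervalIntegral.integral_same
    refine ⟨h0 ▸ Submodule.zero_mem _, ?_⟩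
    have : (⟨∫ s in (0 : ℝ)..0, (ψ₁ s).snd, h0 ▸ Submodule.zero_mem _⟩ : 𝓐.adjoint.domain) = 0 :=
      Subtype.ext h0
    rw [this, LinearPMap.map_zero, add_zero, h.ψ₁_zero]
  obtain ⟨hV, e⟩ := h.ψ₁_eq t ⟨ht0, ht.2⟩
  have hint : IntervalIntegrable ψ₁ volume 0 t :=
    (h.continuous_ψ₁.mono (by rw [uIcc_of_le ht.1]; exact Icc_subset_Icc_right ht.2)).intervalIntegrable
  have hs : (mulI (∫ s in (0 : ℝ)..t, ψ₁ s)).fst = -∫ s in (0 : ℝ)..t, (ψ₁ s).snd := by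
    have := (WithLp.sndL 2 ℝ H H).intervalIntegral_comp_comm hint
    simp only [WithLp.sndL_apply] at this
    rw [this]
    rfl
  have hV' : (∫ s in (0 : ℝ)..t, (ψ₁ s).snd) ∈ 𝓐.adjoint.domain := by
    rw [← neg_mem_iff, ← hs]
    exact hV
  refine ⟨hV', ?_⟩
  have e1 : (⟨_, hV⟩ : 𝓐.adjoint.domain) = -⟨_, hV'⟩ := Subtype.ext hs
  rw [e, e1, LinearPMap.map_neg]
  simp [mulI, ofReal]

lemma norm_eq_norm_snd {z : Cx H} (hz : z ∈ imagSpace H) : ‖z‖ = ‖z.snd‖ := by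
  have h : z.fst = 0 := hz
  rw [← sq_eq_sq₀ (norm_nonneg _) (norm_nonneg _), WithLp.prod_norm_sq_eq_of_L2, h]
  simp

/-- The Yosida approximations of the first component converge uniformly. -/
lemma eventually_norm_psi₁_sub_le (h𝓐 : IsC0Generator 𝓐) (hT : 0 ≤ T)
    (hsol : IsMildSolution p 𝓐 D T u₁ u₂ Φ ψ₁ ψ₂)
    {Φn : ℕ → ℝ → ℝ} {ψ₁n : ℕ → ℝ → Cx H} {ψ₂n : ℕ → ℝ → SelfAdjHS H}
    (hsoln : ∀ᶠ n in atTop, IsMildSolution p (yosida 𝓐 n) D T u₁ u₂ (Φn n) (ψ₁n n) (ψ₂n n))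
    {ε : ℝ} (hε : 0 < ε) : ∀ᶠ n in atTop, ∀ t ∈ Icc 0 T, ‖ψ₁n n t - ψ₁ t‖ ≤ ε := by
  obtain ⟨M, ω, -, -, hres⟩ := h𝓐.hille_yosida
  have hlarge : ∀ᶠ n : ℕ in atTop, ω < n :=
    tendsto_natCast_atTop_atTop.eventually_gt_atTop ω
  have h := h𝓐.eventually_norm_sub_le hT (v₀ := u₁.snd) (v := fun t => (ψ₁ t).snd)
    (vn := fun n t => (ψ₁n n t).snd) hsol.continuousOn_snd (fun t ht => hsol.snd_eq ht)
    (by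
      filter_upwards [hsoln, hlarge] with n hn hnω
      refine ⟨hn.continuousOn_snd, fun t ht => ?_⟩
      obtain ⟨hV, e⟩ := hn.snd_eq ht
      rw [e, adjoint_yosida_apply (hres n hnω).1]
      rfl) hε
  filter_upwards [h, hsoln] with n hn hs t ht
  have h1 : (ψ₁ t).fst = 0 := hsol.ψ₁_mem t ht
  have h2 : (ψ₁n n t).fst = 0 := hs.ψ₁_mem t ht
  have hmem : ψ₁n n t - ψ₁ t ∈ imagSpace H := by simp [imagSpace, h1, h2]
  rw [norm_eq_norm_snd hmem]
  exact hn t ht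

/-- Uniform convergence of the first component entails that of the second one. -/
lemma eventually_norm_psi₂_sub_le (hsol : IsMildSolution p 𝓐 D T u₁ u₂ Φ ψ₁ ψ₂)
    {𝓐n : ℕ → H →ₗ.[ℝ] H} {Φn : ℕ → ℝ → ℝ} {ψ₁n : ℕ → ℝ → Cx H} {ψ₂n : ℕ → ℝ → SelfAdjHS H}
    (hsoln : ∀ᶠ n in atTop, IsMildSolution p (𝓐n n) D T u₁ u₂ (Φn n) (ψ₁n n) (ψ₂n n))
    (hψ₁ : ∀ ε : ℝ, 0 < ε → ∀ᶠ n in atTop, ∀ t ∈ Icc 0 T, ‖ψ₁n n t - ψ₁ t‖ ≤ ε)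
    {ε : ℝ} (hε : 0 < ε) : ∀ᶠ n in atTop, ∀ t ∈ Icc 0 T, ‖ψ₂n n t - ψ₂ t‖ ≤ ε := by
  obtain ⟨r₁, hr₁⟩ := isCompact_Icc.exists_bound_of_continuousOn hsol.continuous_ψ₁
  obtain ⟨r₂, hr₂⟩ := isCompact_Icc.exists_bound_of_continuousOn hsol.contDiff_ψ₂.continuousOn
  set r := max |r₁| |r₂| + 1
  have hr1 : r₁ + 1 ≤ r := by simp only [r]; linarith [le_abs_self r₁, le_max_left |r₁| |r₂|]
  have hr2 : r₂ + 1 ≤ r := by simp only [r]; linarith [le_abs_self r₂, le_max_right |r₁| |r₂|]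
  obtain ⟨L, hL0, hL⟩ := exists_lipschitz_riccatiR p D (r := r) (by positivity)
  set G := (L + 1) * Real.exp ((L + 1) * T)
  have hG : 0 < G := by positivity
  set η := min 1 (min ε 1 / G)
  have hη : 0 < η := by positivity
  have hGη : (L + 1) * η * Real.exp ((L + 1) * T) ≤ min ε 1 := by
    have : η ≤ min ε 1 / G := min_le_right _ _
    rw [le_div_iff₀ hG] at this
    refine le_trans (le_of_eq ?_) this
    simp only [G]
    ring
  filter_upwards [hsoln, hψ₁ η hη] with n hn h1 t ht
  refine (norm_le_of_norm_deriv_le_local (d := fun t => ψ₂n n t - ψ₂ t) hL0 hη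
    (hn.contDiff_ψ₂.continuousOn.sub hsol.contDiff_ψ₂.continuousOn)
    (by simp [hn.ψ₂_zero, hsol.ψ₂_zero]) (fun s hs => (hn.ψ₂_eq s hs).sub (hsol.ψ₂_eq s hs))
    (fun s hs hs1 => ?_) (hGη.trans (min_le_right _ _)) ht).trans (hGη.trans (min_le_left _ _))
  have hs' := Ioc_subset_Icc_self hs
  have h1s := h1 s hs'
  have hη1 : η ≤ 1 := min_le_left _ _
  refine (hL _ (hn.ψ₂_mem s hs') _ (hsol.ψ₂_mem s hs') _ _ ?_ ?_ ?_ ?_).trans ?_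
  · linarith [norm_le_norm_add_norm_sub' (ψ₂n n s) (ψ₂ s), hr₂ s hs']
  · linarith [hr₂ s hs']
  · linarith [norm_le_norm_add_norm_sub' (ψ₁n n s) (ψ₁ s), hr₁ s hs']
  · linarith [hr₁ s hs']
  · gcongr

/-- Uniform convergence of the second component entails that of `Φ`. -/
lemma eventually_norm_Phi_sub_le (hp : p.IsAdmissible) (hT : 0 ≤ T)
    (hsol : IsMildSolution p 𝓐 D T u₁ u₂ Φ ψ₁ ψ₂)
    {𝓐n : ℕ → H →ₗ.[ℝ] H} {Φn : ℕ → ℝ → ℝ} {ψ₁n : ℕ → ℝ → Cx H} {ψ₂n : ℕ → ℝ → SelfAdjHS H}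
    (hsoln : ∀ᶠ n in atTop, IsMildSolution p (𝓐n n) D T u₁ u₂ (Φn n) (ψ₁n n) (ψ₂n n))
    (hψ₂ : ∀ ε : ℝ, 0 < ε → ∀ᶠ n in atTop, ∀ t ∈ Icc 0 T, ‖ψ₂n n t - ψ₂ t‖ ≤ ε)
    {ε : ℝ} (hε : 0 < ε) : ∀ᶠ n in atTop, ∀ t ∈ Icc 0 T, ‖Φn n t - Φ t‖ ≤ ε := by
  obtain ⟨r₂, hr₂⟩ := isCompact_Icc.exists_bound_of_continuousOn hsol.contDiff_ψ₂.continuousOn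
  have hr2 : r₂ ≤ |r₂| := le_abs_self r₂
  obtain ⟨L, hL0, hL⟩ := hp.exists_lipschitz_riccatiF (r := |r₂| + 1) (by positivity)
  have hG : 0 < (L + 1) * (T + 1) := by positivity
  filter_upwards [hsoln, hψ₂ 1 one_pos, hψ₂ (ε / ((L + 1) * (T + 1))) (by positivity)]
    with n hn h1 h2 t ht
  have h := norm_le_of_norm_deriv_le_const (d := fun t => Φn n t - Φ t)
    (C := L * (ε / ((L + 1) * (T + 1)))) (by positivity)
    (hn.contDiff_Φ.continuousOn.sub hsol.contDiff_Φ.continuousOn)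
    (by simp [hn.Φ_zero, hsol.Φ_zero]) (fun s hs => (hn.Φ_eq s hs).sub (hsol.Φ_eq s hs))
    (fun s hs => by
      have hs' := Ioc_subset_Icc_self hs
      refine (hL _ (hn.ψ₂_mem s hs') _ (hsol.ψ₂_mem s hs') ?_ ?_).trans ?_
      · linarith [norm_le_norm_add_norm_sub' (ψ₂n n s) (ψ₂ s), hr₂ s hs', h1 s hs']
      · linarith [hr₂ s hs']
      · gcongr
        exact h2 s hs') ht
  refine h.trans ?_
  calc L * (ε / ((L + 1) * (T + 1))) * T ≤ (L + 1) * (ε / ((L + 1) * (T + 1))) * (T + 1) := by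
        gcongr <;> linarith
    _ = ε := by field_simp

end MildSolution

end YosidaRiccati

theorem proposition3p5 {H : Type*} [NormedAddCommGroup H] [InnerProductSpace ℝ H]
    [CompleteSpace H] [TopologicalSpace.SeparableSpace H]
    (p : YosidaRiccati.ParamSet H) (hp : p.IsAdmissible)
    (𝓐 : H →ₗ.[ℝ] H) (h𝓐 : YosidaRiccati.IsC0Generator 𝓐)
    (D : H →L[ℝ] H) (hD : D.IsPositive)
    (T : ℝ) (hT : 0 ≤ T)
    (u₁ : YosidaRiccati.Cx H) (hu₁ : u₁ ∈ YosidaRiccati.imagSpace H)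
    (u₂ : YosidaRiccati.SelfAdjHS H) (hu₂ : u₂ ∈ YosidaRiccati.posCone H)
    (Φ : ℝ → ℝ) (ψ₁ : ℝ → YosidaRiccati.Cx H) (ψ₂ : ℝ → YosidaRiccati.SelfAdjHS H)
    (hsol : YosidaRiccati.IsMildSolution p 𝓐 D T u₁ u₂ Φ ψ₁ ψ₂)
    (Φn : ℕ → ℝ → ℝ) (ψ₁n : ℕ → ℝ → YosidaRiccati.Cx H)
    (ψ₂n : ℕ → ℝ → YosidaRiccati.SelfAdjHS H)
    (hsoln : ∀ᶠ n in atTop, YosidaRiccati.IsMildSolution p (YosidaRiccati.yosida 𝓐 n) D T u₁ u₂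
      (Φn n) (ψ₁n n) (ψ₂n n)) :
    Tendsto (fun n => ⨆ t ∈ Icc 0 T, ‖Φn n t - Φ t‖ₑ) atTop (𝓝 0) ∧
      Tendsto (fun n => (⨆ t ∈ Icc 0 T, ‖ψ₁n n t - ψ₁ t‖ₑ) + ⨆ t ∈ Icc 0 T, ‖ψ₂n n t - ψ₂ t‖ₑ)
        atTop (𝓝 0) := by
  have h₁ : ∀ ε : ℝ, 0 < ε → ∀ᶠ n in atTop, ∀ t ∈ Icc 0 T, ‖ψ₁n n t - ψ₁ t‖ ≤ ε := fun ε hε =>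
    YosidaRiccati.eventually_norm_psi₁_sub_le h𝓐 hT hsol hsoln hε
  have h₂ : ∀ ε : ℝ, 0 < ε → ∀ᶠ n in atTop, ∀ t ∈ Icc 0 T, ‖ψ₂n n t - ψ₂ t‖ ≤ ε := fun ε hε =>
    YosidaRiccati.eventually_norm_psi₂_sub_le hsol hsoln h₁ hε
  refine ⟨YosidaRiccati.tendsto_iSup_enorm_zero fun ε hε =>
    YosidaRiccati.eventually_norm_Phi_sub_le hp hT hsol hsoln h₂ hε, ?_⟩
  simpa using (YosidaRiccati.tendsto_iSup_enorm_zero h₁).add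
    (YosidaRiccati.tendsto_iSup_enorm_zero h₂)
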